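/- Let $n\ge 1$ be an integer. Let $dV$ be Lebesgue measure on $\mathbb{C}^n$ normalized so that $\int_{\mathbb{C}^n} e^{-|z|^2}\,dV(z)=1$, where $|z|=(\sum_j|z_j|^2)^{1/2}$, and let $H(\mathbb{C}^n)$ be the set of entire functions on $\mathbb{C}^n$. For real $\alpha$ and $0<p<\infty$, let $L^p_\alpha$ be the space of Lebesgue measurable functions $\psi$ on $\mathbb{C}^n$ for which $$\|\psi\|_{L^p_\alpha}=\Big(\int_{\mathbb{C}^n}\big|\psi(z)e^{-|z|^2/2}\big|^p\,\frac{dV(z)}{(1+|z|)^{\alpha}}\Big)^{1/p}$$ is finite, and let $L^\infty_\alpha$ be the space of those for which $$\|\psi\|_{L^\infty_\alpha}=\operatorname*{ess\,sup}_{z\in\mathbb{C}^n}\frac{|\psi(z)|e^{-|z|^2/2}}{(1+|z|)^{\alpha}}$$ is finite. (The term "norm" is used also for $0<p<1$.) For $0<p\le\infty$ the weighted Fock space is $F^p_\alpha=L^p_\alpha\cap H(\mathbb{C}^n)$, with $\|f\|_{F^p_\alpha}=\|f\|_{L^p_\alpha}$. For $f\in H(\mathbb{C}^n)$ with homogeneous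 expansion $f=\sum_{k\ge 0}f_k$, where $f_k$ is a homogeneous polynomial of degree $k$, and for $s$ real, put $$\mathcal{D}^sf=\sum_{k}\frac{\Gamma(n+s+k)}{\Gamma(n+k)}f_k,\qquad \mathcal{I}^sf=\sum_{k}\frac{\Gamma(n+k)}{\Gamma(n+s+k)}f_k,\qquad f_s^-=\sum_{k\le|s|}f_k,$$ where the first two sums run over all $k\ge 0$ if $s\ge 0$ and over $k>|s|$ if $s<0$. Put $$\mathcal{R}^sf(z)=\frac{\mathcal{D}^sf(z)}{(1+|z|)^s},\qquad \tilde{\mathcal{R}}^sf(z)=\frac{\mathcal{I}^{-s}f(z)}{(1+|z|)^s}.$$ For $0<p\le\infty$ and real $\alpha,s$, the Fock–Sobolev spaces are $$F^p_{\alpha,s}=\{f\in H(\mathbb{C}^n):\mathcal{R}^sf\in L^p_\alpha\},\qquad \tilde F^p_{\alpha,s}=\{f\in H(\mathbb{C}^n):\tilde{\mathcal{R}}^sf\in L^p_\alpha\},$$ with norms $$\|f\|_{F^p_{\alpha,s}}=\begin{cases}\|\mathcal{R}^sf\|_{L^p_\alpha}&\text{if } s\ge0,\\ \|\mathcal{R}^sf\|_{L^p_\alpha}+\|f_s^-\|_{F^p_\alpha}&\text{if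 } s<0,\end{cases}\qquad \|f\|_{\tilde F^p_{\alpha,s}}=\begin{cases}\|\tilde{\mathcal{R}}^sf\|_{L^p_\alpha}&\text{if } s\le0,\\ \|\tilde{\mathcal{R}}^sf\|_{L^p_\alpha}+\|f_s^-\|_{F^p_\alpha}&\text{if } s>0.\end{cases}$$ **Theorem 4.2.** Let $s$ and $\alpha$ be real numbers. Then $$F^p_{\alpha,s}=\tilde F^p_{\alpha,s}=\begin{cases}F^p_{\alpha-sp}&\text{if } 0<p<\infty,\\ F^\infty_{\alpha-s}&\text{if } p=\infty,\end{cases}$$ with equivalent norms. That is, for each $0<p\le\infty$ the three spaces consist of the same functions, and there is a constant $C=C(n,p,\alpha,s)>0$ such that, for any two of the three norms $N,N'$, one has $C^{-1}N'(f)\le N(f)\le C\,N'(f)$ for all $f\in H(\mathbb{C}^n)$ (a norm being $+\infty$ when it is not finite). -/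

import Mathlib

open MeasureTheory
open scoped ENNReal NNReal

namespace FockSobolev

noncomputable section

/-- The complex space `ℂⁿ` with the norm `|z| = (∑ |z_j|²)^{1/2}`. -/
abbrev Cn (n : ℕ) : Type := EuclideanSpace ℂ (Fin n)

/-- The volume measure `dV` on `ℂⁿ`: Lebesgue measure divided by `πⁿ`, so that
`∫ exp (-|z|²) dV(z) = 1` (see `integral_gaussian_dV`). -/
def dV (n : ℕ) : Measure (Cn n) :=
  ENNReal.ofReal ((Real.pi ^ n)⁻¹) • (volume : Measure (Fin n → ℂ)).map (WithLp.toLp 2)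

/-- The weighted measure `dV_α(z) = dV(z) / (1 + |z|)^α`. -/
def dVw (n : ℕ) (α : ℝ) : Measure (Cn n) :=
  (dV n).withDensity fun z => ENNReal.ofReal ((1 + ‖z‖) ^ (-α))

/-- The norm of `L^p_α`, with values in `[0, ∞]`. For `0 < p < ∞` it is
`(∫ |ψ(z) exp (-|z|²/2)|^p dV_α(z))^{1/p}`, and for `p = ∞` it is the essential supremum of
`|ψ(z)| exp (-|z|²/2) / (1 + |z|)^α`. -/
def LNorm {n : ℕ} (p : ℝ≥0∞) (α : ℝ) (ψ : Cn n → ℂ) : ℝ≥0∞ :=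
  if p = ∞ then
    essSup (fun z => ENNReal.ofReal (‖ψ z‖ * Real.exp (-‖z‖ ^ 2 / 2) / (1 + ‖z‖) ^ α)) (dV n)
  else
    (∫⁻ z, ENNReal.ofReal (‖ψ z‖ * Real.exp (-‖z‖ ^ 2 / 2)) ^ p.toReal ∂(dVw n α)) ^ (1 / p.toReal)

/-- The space `L^p_α`: Lebesgue measurable functions with finite `L^p_α` norm. -/
def LSpace (n : ℕ) (p : ℝ≥0∞) (α : ℝ) : Set (Cn n → ℂ) :=
  {ψ | AEStronglyMeasurable ψ (dV n) ∧ LNorm p α ψ < ∞}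

/-- The entire functions on `ℂⁿ`. -/
def Entire (n : ℕ) : Set (Cn n → ℂ) := {f | Differentiable ℂ f}

/-- The weighted Fock space `F^p_α`; its norm is `LNorm p α`. -/
def FockSpace (n : ℕ) (p : ℝ≥0∞) (α : ℝ) : Set (Cn n → ℂ) := LSpace n p α ∩ Entire n

/-- The degree `k` part `f_k` of the homogeneous expansion `f = ∑ f_k` of an entire function:
`f_k(z)` is the `k`-th Taylor coefficient at `0` of the entire function `t ↦ f(t z)` of one
variable. -/
def homPart {n : ℕ} (f : Cn n → ℂ) (k : ℕ) (z : Cn n) : ℂ :=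
  (k.factorial : ℂ)⁻¹ * iteratedDeriv k (fun t : ℂ => f (t • z)) 0

/-- The fractional derivative `𝓓^s f`: the series `∑ Γ(n+s+k)/Γ(n+k) f_k`, over all `k ≥ 0` if
`s ≥ 0` and over the `k > |s|` if `s < 0`. -/
def fracDeriv {n : ℕ} (s : ℝ) (f : Cn n → ℂ) (z : Cn n) : ℂ :=
  ∑' k : ℕ, if 0 ≤ s ∨ |s| < (k : ℝ) then
    ((Real.Gamma (n + s + k) / Real.Gamma (n + k) : ℝ) : ℂ) * homPart f k z else 0

/-- The fractional integral `𝓘^s f`: the series `∑ Γ(n+k)/Γ(n+s+k) f_k`, over all `k ≥ 0` if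
`s ≥ 0` and over the `k > |s|` if `s < 0`. -/
def fracInt {n : ℕ} (s : ℝ) (f : Cn n → ℂ) (z : Cn n) : ℂ :=
  ∑' k : ℕ, if 0 ≤ s ∨ |s| < (k : ℝ) then
    ((Real.Gamma (n + k) / Real.Gamma (n + s + k) : ℝ) : ℂ) * homPart f k z else 0

/-- `f_s^- = ∑_{k ≤ |s|} f_k`, the Taylor polynomial of `f` of degree at most `|s|`. -/
def lowPart {n : ℕ} (s : ℝ) (f : Cn n → ℂ) (z : Cn n) : ℂ :=
  ∑ k ∈ Finset.range (⌊|s|⌋₊ + 1), homPart f k z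

/-- The fractional radial differentiation operator `𝓡^s f(z) = (1 + |z|)^{-s} 𝓓^s f(z)`. -/
def radDeriv {n : ℕ} (s : ℝ) (f : Cn n → ℂ) (z : Cn n) : ℂ :=
  (((1 + ‖z‖) ^ s : ℝ) : ℂ)⁻¹ * fracDeriv s f z

/-- The fractional radial integration operator `𝓡~^s f(z) = (1 + |z|)^{-s} 𝓘^{-s} f(z)`. -/
def radInt {n : ℕ} (s : ℝ) (f : Cn n → ℂ) (z : Cn n) : ℂ :=
  (((1 + ‖z‖) ^ s : ℝ) : ℂ)⁻¹ * fracInt (-s) f z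

/-- The weighted Fock-Sobolev space `F^p_{α,s}`: entire `f` with `𝓡^s f ∈ L^p_α`. -/
def FSSpace (n : ℕ) (p : ℝ≥0∞) (α s : ℝ) : Set (Cn n → ℂ) :=
  {f | f ∈ Entire n ∧ radDeriv s f ∈ LSpace n p α}

/-- The norm of `F^p_{α,s}`. -/
def FSNorm {n : ℕ} (p : ℝ≥0∞) (α s : ℝ) (f : Cn n → ℂ) : ℝ≥0∞ :=
  if 0 ≤ s then LNorm p α (radDeriv s f)
  else LNorm p α (radDeriv s f) + LNorm p α (lowPart s f)

/-- The weighted Fock-Sobolev space `F~^p_{α,s}`: entire `f` with `𝓡~^s f ∈ L^p_α`. -/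
def FSTildeSpace (n : ℕ) (p : ℝ≥0∞) (α s : ℝ) : Set (Cn n → ℂ) :=
  {f | f ∈ Entire n ∧ radInt s f ∈ LSpace n p α}

/-- The norm of `F~^p_{α,s}`. -/
def FSTildeNorm {n : ℕ} (p : ℝ≥0∞) (α s : ℝ) (f : Cn n → ℂ) : ℝ≥0∞ :=
  if s ≤ 0 then LNorm p α (radInt s f)
  else LNorm p α (radInt s f) + LNorm p α (lowPart s f)

/-- Two `[0, ∞]`-valued norms are equivalent on the entire functions: each is at most a constant
`0 < C < ∞` times the other one (in particular they are finite for the same functions). -/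
def EquivNorms {n : ℕ} (N N' : (Cn n → ℂ) → ℝ≥0∞) : Prop :=
  ∃ C : ℝ≥0, 0 < C ∧ ∀ f ∈ Entire n, N f ≤ C * N' f ∧ N' f ≤ C * N f

/-- The normalization of `dV`. -/
theorem integral_gaussian_dV (n : ℕ) : ∫ z, Real.exp (-‖z‖ ^ 2) ∂(dV n) = 1 := by
  have h1 : ∫ z : ℂ, Real.exp (-‖z‖ ^ 2) = Real.pi := by
    have := GaussianFourier.integral_rexp_neg_mul_sq_norm (V := ℂ) (b := 1) one_pos
    simpa using this
  have e : (WithLp.toLp 2 : (Fin n → ℂ) → Cn n) = MeasurableEquiv.toLp 2 (Fin n → ℂ) := rfl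
  rw [dV, integral_smul_measure, e, integral_map_equiv]
  have h2 : ∀ x : Fin n → ℂ, Real.exp (-‖MeasurableEquiv.toLp 2 (Fin n → ℂ) x‖ ^ 2)
      = ∏ i, Real.exp (-‖x i‖ ^ 2) := by
    intro x
    rw [← Real.exp_sum, EuclideanSpace.norm_sq_eq]
    simp
  simp_rw [h2]
  rw [integral_fintype_prod_volume_eq_prod (fun _ (z : ℂ) => Real.exp (-‖z‖ ^ 2))]
  have hp : (0 : ℝ) < Real.pi ^ n := pow_pos Real.pi_pos n
  simp only [h1, Finset.prod_const, Finset.card_univ, Fintype.card_fin, smul_eq_mul]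
  rw [ENNReal.toReal_ofReal (by positivity)]
  exact inv_mul_cancel₀ hp.ne'

/-- The homogeneous expansion: `f(z) = ∑ f_k(z)`. -/
theorem hasSum_homPart {n : ℕ} {f : Cn n → ℂ} (hf : f ∈ Entire n) (z : Cn n) :
    HasSum (fun k => homPart f k z) (f z) := by
  have hd : Differentiable ℂ (fun t : ℂ => f (t • z)) :=
    Differentiable.comp (g := f) hf (by fun_prop)
  simpa [homPart] using Complex.hasSum_taylorSeries_of_entire hd 0 1

/-- `f_k` is homogeneous of degree `k`. -/
theorem homPart_smul {n : ℕ} {f : Cn n → ℂ} (hf : f ∈ Entire n) (k : ℕ) (c : ℂ) (z : Cn n) :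
    homPart f k (c • z) = c ^ k * homPart f k z := by
  have hd : Differentiable ℂ (fun t : ℂ => f (t • z)) :=
    Differentiable.comp (g := f) hf (by fun_prop)
  have h := congrFun (iteratedDeriv_comp_const_mul (n := k) (hd.contDiff) c) 0
  simp only [homPart, smul_smul]
  simp only [mul_comm c, zero_mul] at h
  rw [h]
  ring

end

end FockSobolev

open FockSobolev

namespace FockSobolev

/-! Both `𝓓^s` and `𝓘^{-s}` are multipliers `f_k ↦ Γ(a+k)/Γ(b+k) f_k` with `a - b = s`, cut off
below a degree `K` that keeps all Gamma arguments positive. Write `fockNorm p γ` for the `L^p(dV)`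
norm of `|f| exp(-|z|²/2) (1+|z|)^γ`. The heart of the proof is
`exists_fockNorm_multiplier_gammaRatio_le`: such a multiplier maps weight exponent `γ` boundedly to
`γ - 2s`, because one radial derivative costs `|z|²` against the Gaussian. The factor `(1+|z|)^{-s}`
in `𝓡^s` and `𝓡~^s` adds `s` to the exponent admitted for `f`, which produces `α - sp`, or `α - s`
when `p = ∞`.

For `a < b` the Beta integral gives, when `f` vanishes to order `K`, `Γ(c) Tf(z) = ∫₀¹ t^{a-1}
(1-t)^{c-1} f(tz) dt` with `c = b - a`. Against the Gaussian the integrand carries at most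
`exp(-(1-t)|z|²/2)`, so the mass sits at `1 - t ≲ |z|^{-2}`, where `tz` is close to `z`, and
`(1+|z|)^{-2c}` is gained. For `a ≥ b` the order is lowered one unit at a time by the multiplier `k
+ b`, that is `R + b`; a Cauchy estimate on a circle of radius `1/(1+|z|)` bounds it with loss
`(1+|z|)²`.

Both arguments bound the value at `z` by the supremum of `|f| exp(-|·|²/2)` on the unit ball about
`z`, plus a rapidly decreasing multiple of a global weighted supremum.
`exists_fockNorm_le_of_local_bound` turns such a bound into a norm inequality for every `0 < p ≤ ∞`,
by the sub-mean value property of `|f|^p`; this avoids duality and Minkowski's inequality for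
integrals, which fail for `p < 1`.

The reverse estimate comes from the inverse multiplier `Γ(b+k)/Γ(a+k)`, which recovers `f` up to its
Taylor polynomial of degree below `K`; by Cauchy estimates and Gaussian decay that polynomial is
controlled in every weight. -/

/-! ### Invariance of the volume and the sub-mean value property of `|f|^p` -/

instance isAddHaarMeasure_dV (n : ℕ) : (dV n).IsAddHaarMeasure := by
  have h : ((volume : Measure (Fin n → ℂ)).map (WithLp.toLp 2)).IsAddHaarMeasure :=
    (PiLp.continuousLinearEquiv 2 ℝ (fun _ : Fin n => ℂ)).symm.isAddHaarMeasure_map volume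
  unfold dV
  have hp : (0 : ℝ) < (Real.pi ^ n)⁻¹ := by positivity
  exact Measure.IsAddHaarMeasure.smul _ (by simpa using hp) ENNReal.ofReal_ne_top

theorem measurePreserving_unit_smul_dV {n : ℕ} {c : ℂ} (hc : ‖c‖ = 1) :
    MeasurePreserving (fun z : Cn n => c • z) (dV n) (dV n) := by
  have h1 : MeasurePreserving (fun z : ℂ => c * z) volume volume :=
    (rotation ⟨c, by simpa [Submonoid.unitSphere] using hc⟩).measurePreserving
  have h2 : MeasurePreserving (fun (z : Fin n → ℂ) i => c * z i) volume volume :=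
    volume_preserving_pi fun _ => h1
  have hm : Measurable (WithLp.toLp 2 : (Fin n → ℂ) → Cn n) :=
    (MeasurableEquiv.toLp 2 (Fin n → ℂ)).measurable
  have h3 : MeasurePreserving (fun z : Cn n => c • z)
      ((volume : Measure (Fin n → ℂ)).map (WithLp.toLp 2))
      ((volume : Measure (Fin n → ℂ)).map (WithLp.toLp 2)) := by
    refine ⟨by fun_prop, ?_⟩
    rw [Measure.map_map (by fun_prop) hm]
    conv_rhs => rw [← h2.map_eq]
    rw [Measure.map_map hm h2.measurable]
    rfl
  unfold dV
  exact h3.smul_measure _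

/-- Jensen's formula gives `log |g 0| ≤` the circle mean of `log |g|`, since zeros in the disc
contribute nonnegatively; convexity of `exp` then passes to `|g|^p`. The normalization `h1` makes
the convexity inequality survive at zeros of `g`, where `Real.log 0 = 0`. -/
theorem norm_rpow_le_circleAverage_of_one_le {g : ℂ → ℂ} (hg : Differentiable ℂ g) {p : ℝ}
    (hp : 0 < p) (h0 : g 0 ≠ 0) (h1 : 1 ≤ p * Real.log ‖g 0‖) :
    ‖g 0‖ ^ p ≤ Real.circleAverage (fun z => ‖g z‖ ^ p) 0 1 := by
  have hpos : 0 < ‖g 0‖ := norm_pos_iff.mpr h0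
  have han : AnalyticOnNhd ℂ g (Metric.closedBall 0 |1|) := fun z _ => hg.analyticAt z
  have hJ := AnalyticOnNhd.circleAverage_log_norm one_ne_zero han h0
  have hge : Real.log ‖g 0‖ ≤ Real.circleAverage (Real.log ‖g ·‖) 0 1 := by
    rw [hJ]
    have : 0 ≤ ∑ᶠ u, (MeromorphicOn.divisor g (Metric.closedBall 0 |1|) u : ℝ)
        * Real.log (1 * ‖0 - u‖⁻¹) := by
      refine finsum_nonneg fun u => ?_
      by_cases hu : u ∈ Metric.closedBall (0 : ℂ) |1|
      · refine mul_nonneg ?_ ?_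
        · exact_mod_cast MeromorphicOn.AnalyticOnNhd.divisor_nonneg han u
        · rw [abs_one, mem_closedBall_zero_iff] at hu
          by_cases hu0 : u = 0
          · simp [hu0]
          · refine Real.log_nonneg ?_
            rw [one_mul, zero_sub, norm_neg]
            exact (one_le_inv₀ (norm_pos_iff.mpr hu0)).mpr hu
      · simp [Function.locallyFinsuppWithin.apply_eq_zero_of_notMem _ hu]
    linarith
  have hlogint : CircleIntegrable (fun z => Real.log ‖g z‖) 0 1 :=
    MeromorphicOn.circleIntegrable_log_norm fun z _ => (hg.analyticAt z).meromorphicAt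
  have hcont : Continuous fun z => ‖g z‖ ^ p :=
    hg.continuous.norm.rpow_const fun _ => Or.inr hp.le
  have hint : CircleIntegrable (fun z => ‖g z‖ ^ p) 0 1 := hcont.continuousOn.circleIntegrable'
  -- The tangent line to `exp` at `p log |g 0|`. At a zero of `g` the left side is `|g 0|^p (1 - p
  -- log |g 0|)`, nonpositive by `h1`.
  have key : ∀ z, ‖g 0‖ ^ p * p * Real.log ‖g z‖
      + ‖g 0‖ ^ p * (1 - p * Real.log ‖g 0‖) ≤ ‖g z‖ ^ p := by
    intro z
    have hz0 : 0 ≤ ‖g 0‖ ^ p := by positivity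
    by_cases hz : g z = 0
    · rw [hz, norm_zero, Real.zero_rpow hp.ne', Real.log_zero]
      nlinarith
    · have hzp : 0 < ‖g z‖ := norm_pos_iff.mpr hz
      have he := Real.add_one_le_exp (p * Real.log ‖g z‖ - p * Real.log ‖g 0‖)
      have h2 := mul_le_mul_of_nonneg_left he hz0
      have h3 : ‖g 0‖ ^ p * Real.exp (p * Real.log ‖g z‖ - p * Real.log ‖g 0‖) = ‖g z‖ ^ p := by
        rw [Real.rpow_def_of_pos hpos, Real.rpow_def_of_pos hzp, ← Real.exp_add]
        ring_nf
      linarith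
  have hint1 : CircleIntegrable (fun z => ‖g 0‖ ^ p * p * Real.log ‖g z‖) 0 1 :=
    IntervalIntegrable.const_mul hlogint _
  have hint2 : CircleIntegrable (fun _ => ‖g 0‖ ^ p * (1 - p * Real.log ‖g 0‖)) 0 1 :=
    circleIntegrable_const _ _ _
  have hmono := Real.circleAverage_mono (hint1.add hint2) hint (fun z _ => key z)
  rw [Real.circleAverage_add hint1 hint2, Real.circleAverage_const] at hmono
  have hsm := Real.circleAverage_fun_smul (𝕜 := ℝ) (a := ‖g 0‖ ^ p * p)
    (f := fun z => Real.log ‖g z‖) (c := 0) (R := 1)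
  simp only [smul_eq_mul] at hsm
  rw [hsm] at hmono
  have hp0 : 0 ≤ ‖g 0‖ ^ p * p := by positivity
  have := mul_le_mul_of_nonneg_left hge hp0
  linarith

/-- The `p`-th power of the modulus of an entire function of one variable has the sub-mean value
property on circles, for every `p > 0`. -/
theorem norm_rpow_le_circleAverage {g : ℂ → ℂ} (hg : Differentiable ℂ g) {p : ℝ} (hp : 0 < p) :
    ‖g 0‖ ^ p ≤ Real.circleAverage (fun z => ‖g z‖ ^ p) 0 1 := by
  by_cases h0 : g 0 = 0
  · rw [h0, norm_zero, Real.zero_rpow hp.ne']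
    exact Real.circleAverage_nonneg_of_nonneg fun z _ => by positivity
  have hpos : 0 < ‖g 0‖ := norm_pos_iff.mpr h0
  -- Both sides are homogeneous in `g`, so `g` may be rescaled until `p log |g 0| = 1`.
  set r : ℝ := Real.exp (p⁻¹) / ‖g 0‖ with hr
  have hr0 : 0 < r := by positivity
  have hn : ∀ z, ‖(r : ℂ) * g z‖ = r * ‖g z‖ := fun z => by
    rw [norm_mul, Complex.norm_real, Real.norm_of_nonneg hr0.le]
  have := norm_rpow_le_circleAverage_of_one_le (g := fun z => (r : ℂ) * g z) (by fun_prop) hp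
    (by simpa [hr0.ne'] using h0) (by
      rw [hn, hr, div_mul_cancel₀ _ hpos.ne', Real.log_exp, mul_inv_cancel₀ hp.ne'])
  simp only [hn, Real.mul_rpow hr0.le (norm_nonneg _)] at this
  have hsm := Real.circleAverage_fun_smul (𝕜 := ℝ) (a := r ^ p)
    (f := fun z => ‖g z‖ ^ p) (c := 0) (R := 1)
  simp only [smul_eq_mul] at hsm
  rw [hsm] at this
  exact le_of_mul_le_mul_left this (by positivity)

theorem enorm_rpow_le_lintegral_circle {g : ℂ → ℂ} (hg : Differentiable ℂ g) {p : ℝ}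
    (hp : 0 < p) : ENNReal.ofReal (2 * Real.pi) * ‖g 0‖ₑ ^ p ≤
      ∫⁻ θ in Set.Ioc 0 (2 * Real.pi), ‖g (Complex.exp (θ * Complex.I))‖ₑ ^ p := by
  have h := norm_rpow_le_circleAverage hg hp
  have hpi : 0 < 2 * Real.pi := by positivity
  have he : ∀ z, ‖g z‖ₑ ^ p = ENNReal.ofReal (‖g z‖ ^ p) := fun z => by
    rw [← ofReal_norm, ENNReal.ofReal_rpow_of_nonneg (norm_nonneg _) hp.le]
  have hcont : Continuous fun θ : ℝ => ‖g (Complex.exp (θ * Complex.I))‖ ^ p :=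
    (hg.continuous.comp (by fun_prop)).norm.rpow_const fun _ => Or.inr hp.le
  simp only [he]
  rw [← ofReal_integral_eq_lintegral_ofReal
    ((hcont.intervalIntegrable 0 (2 * Real.pi)).1) (ae_of_all _ fun θ => by positivity),
    ← ENNReal.ofReal_mul hpi.le]
  refine ENNReal.ofReal_le_ofReal ?_
  rw [Real.circleAverage_def, intervalIntegral.integral_of_le hpi.le, smul_eq_mul,
    inv_mul_eq_div, le_div_iff₀ hpi] at h
  simpa [circleMap, mul_comm] using h

/-- The sub-mean value property on the unit ball. -/
theorem enorm_rpow_mul_dV_ball_le {n : ℕ} {h : Cn n → ℂ} (hh : h ∈ Entire n) {p : ℝ}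
    (hp : 0 < p) : ‖h 0‖ₑ ^ p * dV n (Metric.ball 0 1) ≤
      ∫⁻ u in Metric.ball 0 1, ‖h u‖ₑ ^ p ∂(dV n) := by
  have hh' : Differentiable ℂ h := hh
  have hc := hh'.continuous
  set B : Set (Cn n) := Metric.ball 0 1
  set I := ∫⁻ u in B, ‖h u‖ₑ ^ p ∂(dV n) with hI
  have hpi : 0 < 2 * Real.pi := by positivity
  -- Averaging over rotations does not change the integral; after Tonelli the inner integral is a
  -- circle mean on the complex line through `u`, so the one-variable inequality applies.
  have hrot : ∀ θ : ℝ, ∫⁻ u in B, ‖h (Complex.exp (θ * Complex.I) • u)‖ₑ ^ p ∂(dV n) = I := by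
    intro θ
    have hn : ‖Complex.exp (θ * Complex.I)‖ = 1 := Complex.norm_exp_ofReal_mul_I θ
    have hmp := measurePreserving_unit_smul_dV (n := n) hn
    have hpre : (fun z : Cn n => Complex.exp (θ * Complex.I) • z) ⁻¹' B = B := by
      ext z
      simp [B, norm_smul, hn]
    have hmeas : Measurable fun u : Cn n => ‖h u‖ₑ ^ p := by fun_prop
    have := hmp.setLIntegral_comp_preimage (s := B) Metric.isOpen_ball.measurableSet hmeas
    rw [hpre] at this
    exact this
  have h1 : ∫⁻ θ in Set.Ioc 0 (2 * Real.pi),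
      ∫⁻ u in B, ‖h (Complex.exp ((θ : ℝ) * Complex.I) • u)‖ₑ ^ p ∂(dV n)
      = ENNReal.ofReal (2 * Real.pi) * I := by
    simp only [hrot, lintegral_const, Measure.restrict_apply MeasurableSet.univ, Set.univ_inter,
      Real.volume_Ioc, sub_zero]
    rw [mul_comm]
  rw [lintegral_lintegral_swap (Continuous.aemeasurable (by
    have : Continuous fun x : ℝ × Cn n => h (Complex.exp ((x.1 : ℝ) * Complex.I) • x.2) :=
      hc.comp (by fun_prop)
    exact (ENNReal.continuous_rpow_const).comp this.enorm))] at h1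
  have h2 : ∫⁻ _ in B, ENNReal.ofReal (2 * Real.pi) * ‖h 0‖ₑ ^ p ∂(dV n) ≤
      ENNReal.ofReal (2 * Real.pi) * I := by
    rw [← h1]
    refine lintegral_mono fun u => ?_
    have := enorm_rpow_le_lintegral_circle (g := fun t : ℂ => h (t • u))
      (Differentiable.comp (g := h) hh' (by fun_prop)) hp
    simpa using this
  rw [lintegral_const, Measure.restrict_apply MeasurableSet.univ, Set.univ_inter, mul_assoc] at h2
  exact (ENNReal.mul_le_mul_iff_right (by simpa using Real.pi_pos) ENNReal.ofReal_ne_top).mp h2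

/-! ### From pointwise local bounds to norm bounds -/

/-- The modulus of `f` against the square root of the Gaussian weight. -/
noncomputable def gaussMod {n : ℕ} (f : Cn n → ℂ) (z : Cn n) : ℝ :=
  ‖f z‖ * Real.exp (-‖z‖ ^ 2 / 2)

/-- The `L^p(dV)` norm of `|f(z)| exp (-|z|²/2) (1 + |z|)^γ`. -/
noncomputable def fockNorm {n : ℕ} (p : ℝ≥0∞) (γ : ℝ) (f : Cn n → ℂ) : ℝ≥0∞ :=
  eLpNorm (fun z => gaussMod f z * (1 + ‖z‖) ^ γ) p (dV n)

theorem gaussMod_nonneg {n : ℕ} (f : Cn n → ℂ) (z : Cn n) : 0 ≤ gaussMod f z := by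
  unfold gaussMod; positivity

theorem continuous_gaussMod {n : ℕ} {f : Cn n → ℂ} (hf : Continuous f) :
    Continuous (gaussMod f) := by
  unfold gaussMod; fun_prop

theorem continuous_one_add_norm_rpow {n : ℕ} (γ : ℝ) :
    Continuous fun z : Cn n => (1 + ‖z‖) ^ γ :=
  (by fun_prop : Continuous fun z : Cn n => 1 + ‖z‖).rpow_const fun z =>
    Or.inl (by positivity)

theorem one_add_norm_rpow_le {n : ℕ} (γ : ℝ) {z w : Cn n} (h : ‖w - z‖ ≤ 2) :
    (1 + ‖z‖) ^ γ ≤ 3 ^ |γ| * (1 + ‖w‖) ^ γ := by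
  have hz : (0 : ℝ) < 1 + ‖z‖ := by positivity
  have hw : (0 : ℝ) < 1 + ‖w‖ := by positivity
  have h1 : ‖z‖ ≤ ‖w‖ + 2 := by
    have := norm_sub_norm_le z w
    rw [norm_sub_rev] at this
    linarith
  have h2 : ‖w‖ ≤ ‖z‖ + 2 := by
    have := norm_sub_norm_le w z
    linarith
  rcases le_total 0 γ with hγ | hγ
  · rw [abs_of_nonneg hγ, ← Real.mul_rpow (by norm_num) hw.le]
    exact Real.rpow_le_rpow hz.le (by linarith [norm_nonneg w]) hγ
  · rw [abs_of_nonpos hγ, Real.rpow_neg (by norm_num), inv_mul_eq_div,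
      le_div_iff₀ (by positivity), ← Real.mul_rpow hz.le (by norm_num)]
    exact Real.rpow_le_rpow_of_nonpos hw (by linarith [norm_nonneg z]) hγ

/-- The Gaussian weight is not subharmonic, but translation to `w` twisted by a holomorphic
exponential turns it into a constant times a factor bounded on the unit ball, so the constant does
not depend on `w`. -/
theorem exists_gaussMod_rpow_le (n : ℕ) {q : ℝ} (hq : 0 < q) :
    ∃ C : ℝ≥0, ∀ f ∈ Entire n, ∀ w : Cn n, ENNReal.ofReal (gaussMod f w) ^ q ≤
      C * ∫⁻ u in Metric.ball w 1, ‖gaussMod f u‖ₑ ^ q ∂(dV n) := by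
  set V := dV n (Metric.ball 0 1) with hV
  have hV0 : V ≠ 0 := (Metric.measure_ball_pos _ _ one_pos).ne'
  have hVt : V ≠ ∞ := measure_ball_lt_top.ne
  refine ⟨(ENNReal.ofReal (Real.exp (1 / 2)) ^ q * V⁻¹).toNNReal, fun f hf w => ?_⟩
  have hC : ENNReal.ofReal (Real.exp (1 / 2)) ^ q * V⁻¹ ≠ ∞ :=
    ENNReal.mul_ne_top (by simp [hq.le]) (by simpa using hV0)
  rw [ENNReal.coe_toNNReal hC]
  have hf' : Differentiable ℂ f := hf
  -- The twist cancels the cross term `2 Re ⟨w, u⟩` in `|w + u|²`. What remains is `exp(|w|²/2)`,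
  -- which cancels from both sides, and `exp(|u|²/2) ≤ exp(1/2)`.
  set h : Cn n → ℂ := fun u => f (w + u) * Complex.exp (-inner ℂ w u) with hh
  have hd : h ∈ Entire n := by
    have h1 : Differentiable ℂ fun u : Cn n => inner ℂ w u := (innerSL ℂ w).differentiable
    have h2 : Differentiable ℂ fun u : Cn n => f (w + u) :=
      Differentiable.comp (g := f) hf' (by fun_prop)
    exact h2.mul (h1.neg.cexp)
  have hmod : ∀ u, ‖h u‖ = gaussMod f (w + u) *
      (Real.exp (‖w‖ ^ 2 / 2) * Real.exp (‖u‖ ^ 2 / 2)) := by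
    intro u
    have h3 : ‖w + u‖ ^ 2 = ‖w‖ ^ 2 + 2 * (inner ℂ w u).re + ‖u‖ ^ 2 := by
      simpa using norm_add_sq (𝕜 := ℂ) w u
    rw [hh, norm_mul, Complex.norm_exp, gaussMod, h3, mul_assoc, ← Real.exp_add, ← Real.exp_add,
      Complex.neg_re]
    ring_nf
  have h0 := enorm_rpow_mul_dV_ball_le hd hq
  set E := ENNReal.ofReal (Real.exp (‖w‖ ^ 2 / 2)) ^ q with hE
  have hE0 : E ≠ 0 := by simp [hE, Real.exp_pos]
  have hEt : E ≠ ∞ := by simp [hE, hq.le]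
  have e0 : ‖h 0‖ₑ ^ q = ENNReal.ofReal (gaussMod f w) ^ q * E := by
    rw [← ofReal_norm, hmod, hE, ← ENNReal.mul_rpow_of_nonneg _ _ hq.le,
      ← ENNReal.ofReal_mul (gaussMod_nonneg _ _)]
    simp
  have hright : ∫⁻ u in Metric.ball 0 1, ‖h u‖ₑ ^ q ∂(dV n) ≤
      E * ENNReal.ofReal (Real.exp (1 / 2)) ^ q *
        ∫⁻ u in Metric.ball w 1, ‖gaussMod f u‖ₑ ^ q ∂(dV n) := by
    have htr : ∫⁻ u in Metric.ball w 1, ‖gaussMod f u‖ₑ ^ q ∂(dV n) =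
        ∫⁻ u in Metric.ball 0 1, ‖gaussMod f (w + u)‖ₑ ^ q ∂(dV n) := by
      have hmp := measurePreserving_add_left (dV n) w
      have hm : Measurable fun u => ‖gaussMod f u‖ₑ ^ q :=
        ((continuous_gaussMod hf'.continuous).measurable.enorm).pow_const q
      rw [← hmp.setLIntegral_comp_preimage (s := Metric.ball w 1)
        Metric.isOpen_ball.measurableSet hm]
      congr 2
      ext u
      simp
    rw [htr, ← lintegral_const_mul' _ _ (ENNReal.mul_ne_top hEt (by simp [hq.le]))]
    refine setLIntegral_mono' Metric.isOpen_ball.measurableSet fun u hu => ?_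
    rw [← ofReal_norm, hmod, Real.enorm_of_nonneg (gaussMod_nonneg _ _), hE,
      ← ENNReal.mul_rpow_of_nonneg _ _ hq.le, ← ENNReal.mul_rpow_of_nonneg _ _ hq.le,
      ← ENNReal.ofReal_mul (by positivity), ← ENNReal.ofReal_mul (by positivity)]
    refine ENNReal.rpow_le_rpow (ENNReal.ofReal_le_ofReal ?_) hq.le
    rw [mul_comm]
    refine mul_le_mul_of_nonneg_right ?_ (gaussMod_nonneg _ _)
    have hu1 : ‖u‖ < 1 := by simpa using hu
    have : ‖u‖ ^ 2 ≤ 1 := by nlinarith [norm_nonneg u]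
    gcongr
  rw [e0] at h0
  have h1 := h0.trans hright
  rw [mul_comm _ E, mul_assoc, mul_assoc,
    ENNReal.mul_le_mul_iff_right hE0 hEt] at h1
  rw [mul_comm _ V⁻¹, mul_assoc, ← ENNReal.div_eq_inv_mul]
  rwa [ENNReal.le_div_iff_mul_le (Or.inl hV0) (Or.inl hVt)]

/-- The `L^p` norm of `|f| exp (-|·|²/2)` over the ball of radius `2` about `z`. -/
noncomputable def localNorm {n : ℕ} (p : ℝ≥0∞) (f : Cn n → ℂ) (z : Cn n) : ℝ≥0∞ :=
  eLpNorm (gaussMod f) p ((dV n).restrict (Metric.ball z 2))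

theorem exists_gaussMod_le_eLpNorm (n : ℕ) {p : ℝ≥0∞} (hp : p ≠ 0) :
    ∃ C : ℝ≥0, ∀ f ∈ Entire n, ∀ w : Cn n, ENNReal.ofReal (gaussMod f w) ≤
      C * eLpNorm (gaussMod f) p ((dV n).restrict (Metric.ball w 1)) := by
  -- For `p = ∞` the case `q = 1` is combined with the comparison of `L¹` and `L^∞` on a ball of
  -- finite measure.
  by_cases hpt : p = ∞
  · obtain ⟨C, hC⟩ := exists_gaussMod_rpow_le n one_pos
    set V := dV n (Metric.ball 0 1) with hV
    have hVt : V ≠ ∞ := measure_ball_lt_top.ne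
    refine ⟨C * V.toNNReal, fun f hf w => ?_⟩
    have hf' : Differentiable ℂ f := hf
    have h1 := hC f hf w
    simp only [ENNReal.rpow_one] at h1
    have h2 := eLpNorm_le_eLpNorm_mul_rpow_measure_univ (p := 1) (q := p)
      (μ := (dV n).restrict (Metric.ball w 1)) (f := gaussMod f) (by simp [hpt])
      (continuous_gaussMod hf'.continuous).aestronglyMeasurable
    rw [eLpNorm_one_eq_lintegral_enorm, Measure.restrict_apply MeasurableSet.univ,
      Set.univ_inter, hpt, Measure.addHaar_ball_center] at h2
    simp only [ENNReal.toReal_one, ENNReal.toReal_top, div_one, div_zero, sub_zero,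
      ENNReal.rpow_one] at h2
    refine h1.trans ?_
    rw [ENNReal.coe_mul, ENNReal.coe_toNNReal hVt, mul_assoc, mul_comm V, hpt]
    gcongr
  · have hq : 0 < p.toReal := ENNReal.toReal_pos hp hpt
    obtain ⟨C, hC⟩ := exists_gaussMod_rpow_le n hq
    refine ⟨C ^ p.toReal⁻¹, fun f hf w => ?_⟩
    have h1 := ENNReal.rpow_le_rpow (hC f hf w) (inv_nonneg.mpr hq.le)
    rw [ENNReal.rpow_rpow_inv hq.ne', ENNReal.mul_rpow_of_nonneg _ _ (inv_nonneg.mpr hq.le)] at h1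
    rw [eLpNorm_eq_lintegral_rpow_enorm_toReal hp hpt, one_div,
      ENNReal.coe_rpow_of_nonneg _ (inv_nonneg.mpr hq.le)]
    exact h1

/-- Radius `2` in `localNorm` is chosen so that the ball contains every unit ball centred within
distance `1` of `z`. -/
theorem exists_gaussMod_le_localNorm (n : ℕ) {p : ℝ≥0∞} (hp : p ≠ 0) :
    ∃ C : ℝ≥0, ∀ f ∈ Entire n, ∀ z w : Cn n, ‖w - z‖ ≤ 1 →
      ENNReal.ofReal (gaussMod f w) ≤ C * localNorm p f z := by
  obtain ⟨C, hC⟩ := exists_gaussMod_le_eLpNorm n hp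
  refine ⟨C, fun f hf z w hzw => (hC f hf w).trans ?_⟩
  unfold localNorm
  gcongr
  refine Metric.ball_subset_ball' ?_
  rw [dist_eq_norm]
  linarith

theorem localNorm_mul_le {n : ℕ} (p : ℝ≥0∞) (γ : ℝ) (f : Cn n → ℂ) (z : Cn n) :
    localNorm p f z * ENNReal.ofReal ((1 + ‖z‖) ^ γ) ≤
      ENNReal.ofReal (3 ^ |γ|) * fockNorm p γ f := by
  have h0 : 0 ≤ (1 + ‖z‖) ^ γ := by positivity
  unfold localNorm fockNorm
  have h1 : eLpNorm (gaussMod f) p ((dV n).restrict (Metric.ball z 2)) *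
      ENNReal.ofReal ((1 + ‖z‖) ^ γ) =
      eLpNorm (((1 + ‖z‖) ^ γ) • gaussMod f) p ((dV n).restrict (Metric.ball z 2)) := by
    rw [eLpNorm_const_smul, Real.enorm_of_nonneg h0, mul_comm]
  have h2 : ENNReal.ofReal (3 ^ |γ|) * eLpNorm (fun z => gaussMod f z * (1 + ‖z‖) ^ γ) p (dV n) =
      eLpNorm ((3 ^ |γ| : ℝ) • fun z => gaussMod f z * (1 + ‖z‖) ^ γ) p (dV n) := by
    rw [eLpNorm_const_smul, Real.enorm_of_nonneg (by positivity)]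
  rw [h1, h2]
  refine le_trans ?_ (eLpNorm_mono_measure _ (Measure.restrict_le_self (s := Metric.ball z 2)))
  refine eLpNorm_mono_ae ?_
  refine (ae_restrict_iff' Metric.isOpen_ball.measurableSet).mpr (ae_of_all _ fun w hw => ?_)
  have hg := gaussMod_nonneg f w
  simp only [Pi.smul_apply, smul_eq_mul]
  rw [Real.norm_of_nonneg (by positivity), Real.norm_of_nonneg (by positivity)]
  have := one_add_norm_rpow_le γ (z := z) (w := w) (by
    rw [Metric.mem_ball, dist_eq_norm] at hw
    exact hw.le)
  nlinarith

/-- Tonelli: each `w` lies in the balls whose centres fill a ball of radius `2` about `w`, of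
measure independent of `w`, and the weight varies by at most `3 ^ |γ|` on such a ball. -/
theorem exists_lintegral_localNorm_le (n : ℕ) {p : ℝ≥0∞} (hp : p ≠ 0) (hpt : p ≠ ∞) (γ : ℝ) :
    ∃ C : ℝ≥0, ∀ f : Cn n → ℂ, Continuous f →
      ∫⁻ z, (localNorm p f z * ENNReal.ofReal ((1 + ‖z‖) ^ γ)) ^ p.toReal ∂(dV n) ≤
        C * fockNorm p γ f ^ p.toReal := by
  have hq : 0 < p.toReal := ENNReal.toReal_pos hp hpt
  set q := p.toReal
  set V := dV n (Metric.ball 0 2) with hV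
  have hVt : V ≠ ∞ := measure_ball_lt_top.ne
  have h3t : ENNReal.ofReal (3 ^ |γ|) ^ q ≠ ∞ := by simp [hq.le]
  refine ⟨(ENNReal.ofReal (3 ^ |γ|) ^ q * V).toNNReal, fun f hf => ?_⟩
  rw [ENNReal.coe_toNNReal (ENNReal.mul_ne_top h3t hVt)]
  set H : Cn n → ℝ≥0∞ := fun w => ‖gaussMod f w * (1 + ‖w‖) ^ γ‖ₑ ^ q with hH
  have hHm : Measurable H :=
    (((continuous_gaussMod hf).mul (continuous_one_add_norm_rpow γ)).measurable.enorm).pow_const q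
  have hN : fockNorm p γ f ^ q = ∫⁻ w, H w ∂(dV n) := by
    rw [fockNorm, eLpNorm_eq_lintegral_rpow_enorm_toReal hp hpt, one_div,
      ENNReal.rpow_inv_rpow hq.ne']
  have hloc : ∀ z, (localNorm p f z * ENNReal.ofReal ((1 + ‖z‖) ^ γ)) ^ q ≤
      ENNReal.ofReal (3 ^ |γ|) ^ q * ∫⁻ w, (Metric.ball z 2).indicator H w ∂(dV n) := by
    intro z
    rw [localNorm, eLpNorm_eq_lintegral_rpow_enorm_toReal hp hpt, one_div,
      ENNReal.mul_rpow_of_nonneg _ _ hq.le, ENNReal.rpow_inv_rpow hq.ne',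
      lintegral_indicator Metric.isOpen_ball.measurableSet, mul_comm,
      ← lintegral_const_mul' _ _ (by simp [hq.le]), ← lintegral_const_mul' _ _ h3t]
    refine setLIntegral_mono' Metric.isOpen_ball.measurableSet fun w hw => ?_
    have hg := gaussMod_nonneg f w
    change ENNReal.ofReal ((1 + ‖z‖) ^ γ) ^ q * ‖gaussMod f w‖ₑ ^ q ≤
      ENNReal.ofReal (3 ^ |γ|) ^ q * ‖gaussMod f w * (1 + ‖w‖) ^ γ‖ₑ ^ q
    rw [Real.enorm_of_nonneg (by positivity), Real.enorm_of_nonneg (by positivity),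
      ← ENNReal.mul_rpow_of_nonneg _ _ hq.le, ← ENNReal.mul_rpow_of_nonneg _ _ hq.le,
      ← ENNReal.ofReal_mul (by positivity), ← ENNReal.ofReal_mul (by positivity)]
    refine ENNReal.rpow_le_rpow (ENNReal.ofReal_le_ofReal ?_) hq.le
    have := one_add_norm_rpow_le γ (z := z) (w := w) (by
      rw [Metric.mem_ball, dist_eq_norm] at hw
      exact hw.le)
    nlinarith
  refine (lintegral_mono hloc).trans ?_
  rw [lintegral_const_mul' _ _ h3t, hN, mul_assoc]
  gcongr
  have hjm : Measurable fun x : Cn n × Cn n => (Metric.ball x.1 2).indicator H x.2 := by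
    have : (fun x : Cn n × Cn n => (Metric.ball x.1 2).indicator H x.2) =
        {x : Cn n × Cn n | dist x.2 x.1 < 2}.indicator fun x => H x.2 := by
      ext x
      simp [Set.indicator]
    rw [this]
    exact (hHm.comp measurable_snd).indicator
      (isOpen_lt (by fun_prop) (by fun_prop)).measurableSet
  rw [lintegral_lintegral_swap hjm.aemeasurable, ← lintegral_const_mul _ hHm]
  refine lintegral_mono fun w => ?_
  have : ∀ z, (Metric.ball z 2).indicator H w = (Metric.ball w 2).indicator (fun _ => H w) z := by
    intro z
    simp [Set.indicator, dist_comm]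
  simp only [this]
  rw [lintegral_indicator_const Metric.isOpen_ball.measurableSet, Measure.addHaar_ball_center,
    mul_comm]

theorem exists_gaussMod_mul_le_fockNorm (n : ℕ) {p : ℝ≥0∞} (hp : p ≠ 0) (γ : ℝ) :
    ∃ C : ℝ≥0, ∀ f ∈ Entire n, ∀ z : Cn n,
      ENNReal.ofReal (gaussMod f z * (1 + ‖z‖) ^ γ) ≤ C * fockNorm p γ f := by
  obtain ⟨C, hC⟩ := exists_gaussMod_le_localNorm n hp
  refine ⟨C * ((3 : ℝ) ^ |γ|).toNNReal, fun f hf z => ?_⟩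
  rw [ENNReal.ofReal_mul (gaussMod_nonneg f z), ENNReal.coe_mul, mul_assoc]
  refine (mul_le_mul_left (hC f hf z z (by simp)) _).trans ?_
  rw [mul_assoc]
  exact mul_le_mul_right (localNorm_mul_le p γ f z) _

theorem lintegral_one_add_norm_rpow_lt_top (n : ℕ) {r : ℝ}
    (hr : (Module.finrank ℝ (Cn n) : ℝ) < r) :
    ∫⁻ z : Cn n, ENNReal.ofReal ((1 + ‖z‖) ^ (-r)) ∂(dV n) < ∞ := by
  have h := (integrable_one_add_norm (μ := dV n) hr).lintegral_lt_top
  exact h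

/-- If `|g|` is controlled at each point by the local suprema of `|f|` in the Fock scale, up to a
rapidly decreasing term, then the norm of `g` is controlled by the norm of `f`. -/
theorem exists_fockNorm_le_of_local_bound (n : ℕ) {p : ℝ≥0∞} (hp : p ≠ 0) (γ : ℝ) :
    ∃ M : ℝ, ∀ γ' K : ℝ, 0 ≤ K → ∃ C : ℝ≥0, ∀ f ∈ Entire n, ∀ g : Cn n → ℂ,
      (∀ z S B, (∀ w, ‖w - z‖ ≤ 1 → gaussMod f w ≤ S) →
        (∀ w, gaussMod f w * (1 + ‖w‖) ^ γ ≤ B) →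
        gaussMod g z * (1 + ‖z‖) ^ γ' ≤ K * ((1 + ‖z‖) ^ γ * S + (1 + ‖z‖) ^ (-M) * B)) →
      fockNorm p γ' g ≤ C * fockNorm p γ f := by
  obtain ⟨C₁, hC₁⟩ := exists_gaussMod_le_localNorm n hp
  obtain ⟨C₂, hC₂⟩ := exists_gaussMod_mul_le_fockNorm n hp γ
  set r : ℝ := Module.finrank ℝ (Cn n) + 1 with hr
  -- With `r` larger than the real dimension, `(1+|z|)^{-M}` has an integrable `p`-th power. For `p
  -- = ∞`, `toReal` is `0` and division by zero makes `M = 0`, which is what is needed there.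
  refine ⟨r / p.toReal, fun γ' K hK => ?_⟩
  set M := r / p.toReal with hM
  -- the pointwise estimate, in terms of `localNorm` and `fockNorm`
  have hpt : ∀ f ∈ Entire n, ∀ g : Cn n → ℂ, fockNorm p γ f ≠ ∞ →
      (∀ z S B, (∀ w, ‖w - z‖ ≤ 1 → gaussMod f w ≤ S) →
        (∀ w, gaussMod f w * (1 + ‖w‖) ^ γ ≤ B) →
        gaussMod g z * (1 + ‖z‖) ^ γ' ≤ K * ((1 + ‖z‖) ^ γ * S + (1 + ‖z‖) ^ (-M) * B)) →
      ∀ z, ‖gaussMod g z * (1 + ‖z‖) ^ γ'‖ₑ ≤ ENNReal.ofReal K *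
        (C₁ * (localNorm p f z * ENNReal.ofReal ((1 + ‖z‖) ^ γ)) +
          C₂ * (fockNorm p γ f * ENNReal.ofReal ((1 + ‖z‖) ^ (-M)))) := by
    intro f hf g hfin H z
    have hg := gaussMod_nonneg g z
    have hloc : localNorm p f z ≠ ∞ := by
      intro htop
      have := localNorm_mul_le p γ f z
      rw [htop, ENNReal.top_mul (by
        simpa using Real.rpow_pos_of_pos (by positivity : (0 : ℝ) < 1 + ‖z‖) γ), top_le_iff] at this
      exact ENNReal.mul_ne_top ENNReal.ofReal_ne_top hfin this
    have h1 := H z (C₁ * localNorm p f z).toReal (C₂ * fockNorm p γ f).toReal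
      (fun w hw => (ENNReal.ofReal_le_iff_le_toReal
        (ENNReal.mul_ne_top ENNReal.coe_ne_top hloc)).mp (hC₁ f hf z w hw))
      (fun w => (ENNReal.ofReal_le_iff_le_toReal
        (ENNReal.mul_ne_top ENNReal.coe_ne_top hfin)).mp (hC₂ f hf w))
    rw [Real.enorm_of_nonneg (by positivity)]
    refine (ENNReal.ofReal_le_ofReal h1).trans (le_of_eq ?_)
    rw [ENNReal.ofReal_mul hK, ENNReal.ofReal_add (by positivity) (by positivity),
      ENNReal.ofReal_mul (by positivity), ENNReal.ofReal_mul (by positivity),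
      ENNReal.ofReal_toReal (ENNReal.mul_ne_top ENNReal.coe_ne_top hloc),
      ENNReal.ofReal_toReal (ENNReal.mul_ne_top ENNReal.coe_ne_top hfin)]
    ring
  by_cases hptop : p = ∞
  · have hM0 : M = 0 := by simp [hM, hptop]
    -- The `+ 1` keeps the constant nonzero, so that the bound is trivial when the norm of `f` is
    -- infinite (`0 * ∞` would be `0`).
    refine ⟨K.toNNReal * (C₁ * ((3 : ℝ) ^ |γ|).toNNReal + C₂) + 1, fun f hf g H => ?_⟩
    by_cases hfin : fockNorm p γ f = ∞
    · rw [hfin, ENNReal.mul_top (by simp)]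
      exact le_top
    have hb := hpt f hf g hfin H
    rw [fockNorm, hptop, eLpNorm_exponent_top]
    refine eLpNormEssSup_le_of_ae_enorm_bound (ae_of_all _ fun z => (hb z).trans ?_)
    rw [← hptop, hM0, neg_zero, Real.rpow_zero, ENNReal.ofReal_one, mul_one]
    push_cast
    rw [add_mul, mul_assoc, add_mul, mul_assoc (C₁ : ℝ≥0∞)]
    refine le_trans ?_ le_self_add
    have := localNorm_mul_le p γ f z
    unfold ENNReal.ofReal at this ⊢
    gcongr
  · have hq : 0 < p.toReal := ENNReal.toReal_pos hp hptop
    obtain ⟨C₃, hC₃⟩ := exists_lintegral_localNorm_le n hp hptop γ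
    set q := p.toReal with hqdef
    set I := ∫⁻ z : Cn n, ENNReal.ofReal ((1 + ‖z‖) ^ (-r)) ∂(dV n) with hI
    have hIt : I ≠ ∞ := (lintegral_one_add_norm_rpow_lt_top n (by simp [hr])).ne
    set D : ℝ≥0∞ := (ENNReal.ofReal K * 2) ^ q * (C₁ ^ q * C₃ + C₂ ^ q * I) with hD
    have hDt : D ≠ ∞ := by
      refine ENNReal.mul_ne_top (by simp [hq.le, ENNReal.mul_eq_top]) ?_
      refine ENNReal.add_ne_top.mpr ⟨ENNReal.mul_ne_top (by simp [hq.le]) (by simp),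
        ENNReal.mul_ne_top (by simp [hq.le]) hIt⟩
    refine ⟨(D ^ q⁻¹).toNNReal + 1, fun f hf g H => ?_⟩
    by_cases hfin : fockNorm p γ f = ∞
    · rw [hfin, ENNReal.mul_top (by simp)]
      exact le_top
    have hf' : Differentiable ℂ f := hf
    have hb := hpt f hf g hfin H
    have hint : ∫⁻ z, ‖gaussMod g z * (1 + ‖z‖) ^ γ'‖ₑ ^ q ∂(dV n) ≤ D * fockNorm p γ f ^ q := by
      have hpw : ∀ z, ‖gaussMod g z * (1 + ‖z‖) ^ γ'‖ₑ ^ q ≤ (ENNReal.ofReal K * 2) ^ q *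
          (C₁ ^ q * (localNorm p f z * ENNReal.ofReal ((1 + ‖z‖) ^ γ)) ^ q +
            C₂ ^ q * fockNorm p γ f ^ q * ENNReal.ofReal ((1 + ‖z‖) ^ (-r))) := by
        intro z
        refine (ENNReal.rpow_le_rpow (hb z) hq.le).trans ?_
        have hr' : ENNReal.ofReal ((1 + ‖z‖) ^ (-r)) = ENNReal.ofReal ((1 + ‖z‖) ^ (-M)) ^ q := by
          rw [ENNReal.ofReal_rpow_of_nonneg (by positivity) hq.le, ← Real.rpow_mul (by positivity),
            hM, neg_mul, div_mul_cancel₀ _ hq.ne']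
        rw [hr', mul_assoc, ← ENNReal.mul_rpow_of_nonneg _ _ hq.le,
          ← ENNReal.mul_rpow_of_nonneg _ _ hq.le, ← ENNReal.mul_rpow_of_nonneg _ _ hq.le,
          ENNReal.mul_rpow_of_nonneg _ _ hq.le, ENNReal.mul_rpow_of_nonneg _ _ hq.le, mul_assoc]
        gcongr
        generalize (C₁ : ℝ≥0∞) * (localNorm p f z * ENNReal.ofReal ((1 + ‖z‖) ^ γ)) = a
        generalize (C₂ : ℝ≥0∞) * (fockNorm p γ f * ENNReal.ofReal ((1 + ‖z‖) ^ (-M))) = b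
        -- Passing through the maximum gives `(a + b)^q ≤ 2^q (a^q + b^q)` for all `q > 0` at once.
        have h2 : a + b ≤ 2 * max a b := by
          rw [two_mul]
          exact add_le_add (le_max_left _ _) (le_max_right _ _)
        refine (ENNReal.rpow_le_rpow h2 hq.le).trans ?_
        rw [ENNReal.mul_rpow_of_nonneg _ _ hq.le]
        gcongr
        rcases le_total a b with h | h
        · rw [max_eq_right h]
          exact le_add_self
        · rw [max_eq_left h]
          exact le_self_add
      refine (lintegral_mono hpw).trans ?_
      have hm : Measurable fun z : Cn n => ENNReal.ofReal ((1 + ‖z‖) ^ (-r)) :=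
        (continuous_one_add_norm_rpow (-r)).measurable.ennreal_ofReal
      rw [lintegral_const_mul' _ _ (by simp [hq.le, ENNReal.mul_eq_top]),
        lintegral_add_right _ (hm.const_mul _), lintegral_const_mul' _ _ (by simp [hq.le]),
        lintegral_const_mul _ hm, ← hI]
      have e : D * fockNorm p γ f ^ q = (ENNReal.ofReal K * 2) ^ q *
          (C₁ ^ q * (C₃ * fockNorm p γ f ^ q) + C₂ ^ q * fockNorm p γ f ^ q * I) := by
        rw [hD]
        ring
      rw [e]
      gcongr
      exact hC₃ f hf'.continuous
    rw [fockNorm, eLpNorm_eq_lintegral_rpow_enorm_toReal hp hptop, one_div]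
    refine (ENNReal.rpow_le_rpow hint (inv_nonneg.mpr hq.le)).trans ?_
    rw [ENNReal.mul_rpow_of_nonneg _ _ (inv_nonneg.mpr hq.le), ENNReal.rpow_rpow_inv hq.ne',
      ENNReal.coe_add, ENNReal.coe_toNNReal (by simp [hq.le, hDt]), add_mul]
    exact le_self_add

/-! ### Cauchy estimates and integral formulas for homogeneous parts -/

theorem exists_norm_le_of_norm_le {n : ℕ} {E : Type*} [NormedAddCommGroup E] {f : Cn n → E}
    (hf : Continuous f) (R : ℝ) : ∃ S, 0 ≤ S ∧ ∀ w, ‖w‖ ≤ R → ‖f w‖ ≤ S := by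
  obtain ⟨S, hS⟩ := (isCompact_closedBall (0 : Cn n) R).exists_bound_of_continuousOn
    hf.continuousOn
  exact ⟨max S 0, le_max_right _ _,
    fun w hw => (hS w (by simpa using hw)).trans (le_max_left _ _)⟩

theorem differentiable_slice {n : ℕ} {f : Cn n → ℂ} (hf : f ∈ Entire n) (z : Cn n) :
    Differentiable ℂ fun t : ℂ => f (t • z) :=
  Differentiable.comp (g := f) hf (by fun_prop)

theorem norm_homPart_mul_pow_le {n : ℕ} {f : Cn n → ℂ} (hf : f ∈ Entire n) (k : ℕ) (z : Cn n)
    {r S : ℝ} (hr : 0 < r) (hS : ∀ t : ℂ, ‖t‖ = r → ‖f (t • z)‖ ≤ S) :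
    ‖homPart f k z‖ * r ^ k ≤ S := by
  have h := Complex.norm_iteratedDeriv_le_of_forall_mem_sphere_norm_le (c := 0) k hr
    (differentiable_slice hf z).diffContOnCl (fun t ht => hS t (by simpa using ht))
  have hk : (0 : ℝ) < k.factorial := by positivity
  have hrk : (0 : ℝ) < r ^ k := by positivity
  rw [homPart, norm_mul, norm_inv, Complex.norm_natCast, ← le_div_iff₀ hrk]
  rw [inv_mul_le_iff₀ hk, ← mul_div_assoc]
  exact h

theorem exists_norm_fderiv_le {n : ℕ} {f : Cn n → ℂ} (hf : f ∈ Entire n) (R : ℝ) :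
    ∃ S, 0 ≤ S ∧ ∀ w, ‖w‖ ≤ R → ‖fderiv ℂ f w‖ ≤ S := by
  have hf' : Differentiable ℂ f := hf
  obtain ⟨S, hS0, hS⟩ := exists_norm_le_of_norm_le hf'.continuous (R + 1)
  refine ⟨2 * S, by positivity, fun w hw => ?_⟩
  have := Complex.norm_fderiv_le_div_of_mapsTo_ball (f := f) (c := w) (R₁ := 1) (R₂ := 2 * S)
    hf'.differentiableOn (fun u hu => ?_) one_pos
  · simpa using this
  · rw [mem_ball_iff_norm] at hu
    rw [mem_closedBall_iff_norm]
    have h1 : ‖u‖ ≤ R + 1 := by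
      have := norm_sub_norm_le u w
      linarith
    have := norm_sub_le (f u) (f w)
    have := hS u h1
    have := hS w (by linarith)
    linarith

/-- Superpositions of dilates of an entire function are entire. -/
theorem entire_integral_smul {n : ℕ} {f : Cn n → ℂ} (hf : f ∈ Entire n) {c Φ : ℝ → ℂ}
    (hc : Continuous c) (hΦ : Continuous Φ) {a b : ℝ} :
    (fun z : Cn n => ∫ t in a..b, Φ t * f (c t • z)) ∈ Entire n := by
  intro z₀
  have hf' : Differentiable ℂ f := hf
  have hfc := hf'.continuous
  obtain ⟨A, hA⟩ := isCompact_uIcc (a := a) (b := b) |>.exists_bound_of_continuousOn hc.continuousOn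
  obtain ⟨S, hS0, hS⟩ := exists_norm_fderiv_le hf (A * (‖z₀‖ + 1))
  refine (intervalIntegral.hasFDerivAt_integral_of_dominated_of_fderiv_le
    (F := fun z t => Φ t * f (c t • z)) (F' := fun z t => (Φ t * c t) • fderiv ℂ f (c t • z))
    (bound := fun t => ‖Φ t * c t‖ * S) (Metric.ball_mem_nhds z₀ one_pos)
    (Filter.Eventually.of_forall fun z => ?_) ?_ ?_ ?_ ?_ ?_).differentiableAt
  · exact (hΦ.mul (hfc.comp (by fun_prop))).aestronglyMeasurable
  · exact (hΦ.mul (hfc.comp (by fun_prop))).intervalIntegrable _ _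
  · have h1 : Measurable fun t => fderiv ℂ f (c t • z₀) :=
      (measurable_fderiv ℂ f).comp (by fun_prop)
    exact ((hΦ.mul hc).aestronglyMeasurable).smul h1.aestronglyMeasurable
  · refine ae_of_all _ fun t ht z hz => ?_
    rw [norm_smul]
    refine mul_le_mul_of_nonneg_left (hS _ ?_) (norm_nonneg _)
    rw [norm_smul]
    have hz1 : ‖z‖ ≤ ‖z₀‖ + 1 := by
      have := norm_sub_norm_le z z₀
      rw [mem_ball_iff_norm] at hz
      linarith
    exact mul_le_mul (hA t (Set.uIoc_subset_uIcc ht)) hz1 (norm_nonneg _)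
      ((norm_nonneg _).trans (hA t (Set.uIoc_subset_uIcc ht)))
  · exact ((hΦ.mul hc).norm.mul continuous_const).intervalIntegrable _ _
  · refine ae_of_all _ fun t _ z _ => ?_
    have h1 : HasFDerivAt (fun z : Cn n => c t • z) (c t • ContinuousLinearMap.id ℂ (Cn n)) z :=
      (hasFDerivAt_id z).const_smul (c t)
    have h2 := ((hf' (c t • z)).hasFDerivAt.comp z h1).const_mul (Φ t)
    have e : (Φ t * c t) • fderiv ℂ f (c t • z) =
        Φ t • (fderiv ℂ f (c t • z)).comp (c t • ContinuousLinearMap.id ℂ (Cn n)) := by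
      ext v
      simp [mul_assoc]
    rw [e]
    exact h2

/-- The kernel of Cauchy's formula for the `k`-th Taylor coefficient on the circle `|ζ| = 2`. -/
noncomputable def cauchyWeight (k : ℕ) (θ : ℝ) : ℂ :=
  (2 * Real.pi : ℂ)⁻¹ * (circleMap 0 2 θ)⁻¹ ^ k

theorem continuous_cauchyWeight (k : ℕ) : Continuous (cauchyWeight k) := by
  have h : ∀ θ, circleMap 0 2 θ ≠ 0 := fun θ => circleMap_ne_center two_ne_zero
  unfold cauchyWeight
  exact continuous_const.mul (((continuous_circleMap 0 2).inv₀ h).pow k)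

theorem norm_cauchyWeight (k : ℕ) (θ : ℝ) :
    ‖cauchyWeight k θ‖ = (2 * Real.pi)⁻¹ * (1 / 2) ^ k := by
  rw [cauchyWeight, norm_mul, norm_pow, norm_inv, norm_inv, norm_circleMap_zero, abs_two]
  simp [abs_of_pos Real.pi_pos]

theorem homPart_eq_integral {n : ℕ} {f : Cn n → ℂ} (hf : f ∈ Entire n) (k : ℕ) (z : Cn n) :
    homPart f k z = ∫ θ in (0 : ℝ)..2 * Real.pi,
      cauchyWeight k θ * f (circleMap 0 2 θ • z) := by
  have h := DifferentiableOn.circleIntegral_one_div_sub_center_pow_smul (c := 0) (R := 2) two_pos k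
    (differentiable_slice hf z).differentiableOn
  have h2 : homPart f k z = (2 * Real.pi * Complex.I)⁻¹ *
      ∮ t in C(0, 2), (1 / (t - 0) ^ (k + 1)) • f (t • z) := by
    rw [h, homPart, smul_eq_mul]
    have : (2 * Real.pi * Complex.I : ℂ) ≠ 0 := by simp [Real.pi_ne_zero]
    field_simp
  rw [h2, circleIntegral, ← intervalIntegral.integral_const_mul]
  refine intervalIntegral.integral_congr fun θ _ => ?_
  have hθ : circleMap 0 2 θ ≠ 0 := circleMap_ne_center two_ne_zero
  have hpi : (Real.pi : ℂ) ≠ 0 := by simp [Real.pi_ne_zero]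
  simp only [deriv_circleMap, smul_eq_mul, sub_zero, cauchyWeight, inv_pow]
  field_simp
  ring

theorem entire_homPart {n : ℕ} {f : Cn n → ℂ} (hf : f ∈ Entire n) (k : ℕ) :
    homPart f k ∈ Entire n := by
  have h : homPart f k = fun z => ∫ θ in (0 : ℝ)..2 * Real.pi,
      cauchyWeight k θ * f (circleMap 0 2 θ • z) := by
    ext z
    exact homPart_eq_integral hf k z
  rw [h]
  exact entire_integral_smul hf (continuous_circleMap 0 2) (continuous_cauchyWeight k)

/-! ### Multiplier operators on entire functions -/

/-- The multiplier operator `∑ f_k ↦ ∑ m_k f_k`. -/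
noncomputable def multiplier {n : ℕ} (m : ℕ → ℝ) (f : Cn n → ℂ) (z : Cn n) : ℂ :=
  ∑' k, (m k : ℂ) * homPart f k z

/-- A growth condition on multipliers that is much weaker than polynomial growth. -/
def SlowGrowth (m : ℕ → ℝ) : Prop := Summable fun k => |m k| * (1 / 2 : ℝ) ^ k

theorem summable_norm_multiplier {n : ℕ} {m : ℕ → ℝ} (hm : SlowGrowth m) {f : Cn n → ℂ}
    (hf : f ∈ Entire n) (z : Cn n) : Summable fun k => ‖(m k : ℂ) * homPart f k z‖ := by
  have hf' : Differentiable ℂ f := hf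
  obtain ⟨S, hS0, hS⟩ := exists_norm_le_of_norm_le hf'.continuous (2 * ‖z‖)
  refine Summable.of_nonneg_of_le (fun _ => norm_nonneg _) (fun k => ?_) (hm.mul_right S)
  have h := norm_homPart_mul_pow_le hf k z two_pos (S := S)
    (fun t ht => hS _ (by rw [norm_smul, ht]))
  rw [norm_mul, Complex.norm_real, Real.norm_eq_abs, mul_assoc]
  refine mul_le_mul_of_nonneg_left ?_ (abs_nonneg _)
  rw [one_div, inv_pow, ← div_eq_inv_mul, le_div_iff₀ (by positivity)]
  exact h

theorem hasSum_multiplier {n : ℕ} {m : ℕ → ℝ} (hm : SlowGrowth m) {f : Cn n → ℂ}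
    (hf : f ∈ Entire n) (z : Cn n) :
    HasSum (fun k => (m k : ℂ) * homPart f k z) (multiplier m f z) :=
  (summable_norm_multiplier hm hf z).of_norm.hasSum

/-- Cauchy's formula on the circle of radius `2` writes the operator as a superposition of dilates
of `f` with the continuous kernel `∑ m_k` `cauchyWeight k`. That radius is the source of the factor
`(1/2)^k` in `SlowGrowth`. -/
theorem entire_multiplier {n : ℕ} {m : ℕ → ℝ} (hm : SlowGrowth m) {f : Cn n → ℂ}
    (hf : f ∈ Entire n) : multiplier m f ∈ Entire n := by
  have hf' : Differentiable ℂ f := hf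
  have hbd : ∀ k θ, ‖(m k : ℂ) * cauchyWeight k θ‖ ≤
      (2 * Real.pi)⁻¹ * (|m k| * (1 / 2 : ℝ) ^ k) := fun k θ => by
    rw [norm_mul, norm_cauchyWeight, Complex.norm_real, Real.norm_eq_abs]
    exact le_of_eq (by ring)
  have hsum : Summable fun k => (2 * Real.pi)⁻¹ * (|m k| * (1 / 2 : ℝ) ^ k) := hm.mul_left _
  set Φ : ℝ → ℂ := fun θ => ∑' k, (m k : ℂ) * cauchyWeight k θ with hΦ
  have hΦc : Continuous Φ :=
    continuous_tsum (fun k => continuous_const.mul (continuous_cauchyWeight k)) hsum hbd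
  have hΦs : ∀ θ, HasSum (fun k => (m k : ℂ) * cauchyWeight k θ) (Φ θ) := fun θ =>
    (Summable.of_norm_bounded hsum fun k => hbd k θ).hasSum
  have h : multiplier m f = fun z => ∫ θ in (0 : ℝ)..2 * Real.pi,
      Φ θ * f (circleMap 0 2 θ • z) := by
    ext z
    obtain ⟨S, hS0, hS⟩ := exists_norm_le_of_norm_le hf'.continuous (2 * ‖z‖)
    have hfc : Continuous fun θ : ℝ => f (circleMap 0 2 θ • z) :=
      hf'.continuous.comp (by fun_prop)
    refine HasSum.unique (hasSum_multiplier hm hf z) ?_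
    have := intervalIntegral.hasSum_integral_of_dominated_convergence (μ := volume) (a := 0)
      (b := 2 * Real.pi)
      (F := fun k θ => (m k : ℂ) * cauchyWeight k θ * f (circleMap 0 2 θ • z))
      (f := fun θ => Φ θ * f (circleMap 0 2 θ • z))
      (fun k _ => (2 * Real.pi)⁻¹ * (|m k| * (1 / 2 : ℝ) ^ k) * S)
      (fun k => ((continuous_const.mul (continuous_cauchyWeight k)).mul hfc).aestronglyMeasurable)
      (fun k => ae_of_all _ fun θ _ => by
        rw [norm_mul]
        exact mul_le_mul (hbd k θ) (hS _ (by rw [norm_smul, norm_circleMap_zero, abs_two]))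
          (norm_nonneg _) (by positivity))
      (ae_of_all _ fun θ _ => hsum.mul_right S) (by simp)
      (ae_of_all _ fun θ _ => (hΦs θ).mul_right _)
    have e : (fun k => (m k : ℂ) * homPart f k z) = fun k => ∫ θ in (0 : ℝ)..2 * Real.pi,
        (m k : ℂ) * cauchyWeight k θ * f (circleMap 0 2 θ • z) := by
      ext k
      rw [homPart_eq_integral hf k z, ← intervalIntegral.integral_const_mul]
      simp only [mul_assoc]
    rw [e]
    exact this
  rw [h]
  exact entire_integral_smul hf (continuous_circleMap 0 2) hΦc

/-- Uniqueness of power series; it identifies the homogeneous parts of a multiplier's output, so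
that multipliers compose. -/
theorem taylorCoeff_eq_of_hasSum {g : ℂ → ℂ} (hg : Differentiable ℂ g) {c : ℕ → ℂ}
    (h : ∀ t : ℂ, HasSum (fun k => t ^ k * c k) (g t)) (k : ℕ) :
    (k.factorial : ℂ)⁻¹ * iteratedDeriv k g 0 = c k := by
  have h1 := (hg.analyticAt 0).hasFPowerSeriesAt
  have h2 : HasFPowerSeriesAt g (FormalMultilinearSeries.ofScalars ℂ c) 0 := by
    rw [hasFPowerSeriesAt_iff]
    refine Filter.Eventually.of_forall fun t => ?_
    simpa using h t
  have h3 := congrArg (fun p => FormalMultilinearSeries.coeff p k)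
    (h1.eq_formalMultilinearSeries h2)
  simpa [div_eq_inv_mul] using h3

theorem homPart_multiplier {n : ℕ} {m : ℕ → ℝ} (hm : SlowGrowth m) {f : Cn n → ℂ}
    (hf : f ∈ Entire n) (k : ℕ) (z : Cn n) :
    homPart (multiplier m f) k z = (m k : ℂ) * homPart f k z := by
  refine taylorCoeff_eq_of_hasSum (c := fun k => (m k : ℂ) * homPart f k z)
    (differentiable_slice (entire_multiplier hm hf) z) (fun t => ?_) k
  have := hasSum_multiplier hm hf (t • z)
  simp only [homPart_smul hf] at this
  convert this using 2 with k
  ring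

theorem multiplier_multiplier {n : ℕ} {m m' : ℕ → ℝ} (hm : SlowGrowth m) {f : Cn n → ℂ}
    (hf : f ∈ Entire n) (z : Cn n) :
    multiplier m' (multiplier m f) z = multiplier (fun k => m' k * m k) f z := by
  unfold multiplier
  refine tsum_congr fun k => ?_
  have := homPart_multiplier hm hf k z
  unfold multiplier at this
  rw [this]
  push_cast
  ring

/-! ### Exponential decay and Beta integrals -/

theorem exists_rpow_mul_exp_neg_le (β M : ℝ) {a : ℝ} (ha : 0 < a) :
    ∃ C, 0 ≤ C ∧ ∀ x : ℝ, 0 ≤ x → (1 + x) ^ β * Real.exp (-(a * x)) ≤ C * (1 + x) ^ (-M) := by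
  obtain ⟨N, hN⟩ := exists_nat_ge (β + M)
  refine ⟨N.factorial / a ^ N * Real.exp a, by positivity, fun x hx => ?_⟩
  have h1 : (0 : ℝ) < 1 + x := by positivity
  have h2 : (1 + x) ^ (β + M) ≤ (1 + x) ^ N := by
    rw [← Real.rpow_natCast]
    exact Real.rpow_le_rpow_of_exponent_le (by linarith) hN
  have h3 := Real.pow_div_factorial_le_exp (x := a * (1 + x)) (by positivity) N
  rw [div_le_iff₀ (by positivity), mul_pow] at h3
  have h4 : (1 + x) ^ N ≤ N.factorial / a ^ N * Real.exp a * Real.exp (a * x) := by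
    rw [mul_assoc, ← Real.exp_add, div_mul_eq_mul_div, le_div_iff₀ (by positivity)]
    calc (1 + x) ^ N * a ^ N = a ^ N * (1 + x) ^ N := by ring
      _ ≤ _ := h3
      _ = _ := by ring_nf
  rw [Real.rpow_add h1] at h2
  rw [Real.rpow_neg h1.le, ← div_eq_mul_inv, le_div_iff₀ (by positivity)]
  calc (1 + x) ^ β * Real.exp (-(a * x)) * (1 + x) ^ M
      = (1 + x) ^ β * (1 + x) ^ M * Real.exp (-(a * x)) := by ring
    _ ≤ N.factorial / a ^ N * Real.exp a * Real.exp (a * x) * Real.exp (-(a * x)) :=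
        mul_le_mul_of_nonneg_right (h2.trans h4) (Real.exp_pos _).le
    _ = _ := by rw [mul_assoc _ (Real.exp (a * x)), ← Real.exp_add]; simp

theorem exists_rpow_mul_exp_neg_sq_le (β M : ℝ) {a : ℝ} (ha : 0 < a) :
    ∃ C, 0 ≤ C ∧ ∀ x : ℝ, 0 ≤ x →
      (1 + x) ^ β * Real.exp (-(a * x ^ 2)) ≤ C * (1 + x) ^ (-M) := by
  obtain ⟨C, hC0, hC⟩ := exists_rpow_mul_exp_neg_le β M ha
  refine ⟨Real.exp a * C, by positivity, fun x hx => ?_⟩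
  have h1 : Real.exp (-(a * x ^ 2)) ≤ Real.exp a * Real.exp (-(a * x)) := by
    rw [← Real.exp_add, Real.exp_le_exp]
    nlinarith [sq_nonneg (x - 1)]
  calc (1 + x) ^ β * Real.exp (-(a * x ^ 2))
      ≤ (1 + x) ^ β * (Real.exp a * Real.exp (-(a * x))) := by gcongr
    _ = Real.exp a * ((1 + x) ^ β * Real.exp (-(a * x))) := by ring
    _ ≤ Real.exp a * (C * (1 + x) ^ (-M)) :=
        mul_le_mul_of_nonneg_left (hC x hx) (Real.exp_pos _).le
    _ = _ := by ring

theorem ofReal_beta_integrand (a c : ℝ) {t : ℝ} (ht : t ∈ Set.Icc (0 : ℝ) 1) :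
    ((t : ℂ) ^ ((a : ℂ) - 1) * (1 - t) ^ ((c : ℂ) - 1)) =
      ((t ^ (a - 1) * (1 - t) ^ (c - 1) : ℝ) : ℂ) := by
  rw [Complex.ofReal_mul, Complex.ofReal_cpow ht.1, Complex.ofReal_cpow (by linarith [ht.2])]
  push_cast
  rfl

theorem integrableOn_beta {a c : ℝ} (ha : 0 < a) (hc : 0 < c) :
    IntegrableOn (fun t : ℝ => t ^ (a - 1) * (1 - t) ^ (c - 1)) (Set.Ioc 0 1) := by
  have h := (Complex.betaIntegral_convergent (u := a) (v := c) (by simpa) (by simpa)).1.re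
  refine IntegrableOn.congr_fun h (fun t ht => ?_) measurableSet_Ioc
  have := ofReal_beta_integrand a c ⟨ht.1.le, ht.2⟩
  simp only [this]
  exact Complex.ofReal_re _

theorem integral_beta {a c : ℝ} (ha : 0 < a) (hc : 0 < c) :
    ∫ t in Set.Ioc (0 : ℝ) 1, t ^ (a - 1) * (1 - t) ^ (c - 1) =
      Real.Gamma a * Real.Gamma c / Real.Gamma (a + c) := by
  have h := ProbabilityTheory.beta_eq_betaIntegralReal a c ha hc
  rw [ProbabilityTheory.beta] at h
  rw [h, Complex.betaIntegral, intervalIntegral.integral_of_le zero_le_one]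
  have : ∫ t in Set.Ioc (0 : ℝ) 1, ((t : ℂ) ^ ((a : ℂ) - 1) * (1 - t) ^ ((c : ℂ) - 1)) =
      ∫ t in Set.Ioc (0 : ℝ) 1, ((t ^ (a - 1) * (1 - t) ^ (c - 1) : ℝ) : ℂ) :=
    setIntegral_congr_fun measurableSet_Ioc fun t ht =>
      ofReal_beta_integrand a c ⟨ht.1.le, ht.2⟩
  rw [this, integral_complex_ofReal, Complex.ofReal_re]

theorem integrableOn_and_integral_one_sub_rpow_mul_exp_le {c X : ℝ} (hc : 0 < c) (hX : 0 < X) :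
    IntegrableOn (fun t : ℝ => (1 - t) ^ (c - 1) * Real.exp (-(X * (1 - t)))) (Set.Ioc 0 1) ∧
      ∫ t in Set.Ioc (0 : ℝ) 1, (1 - t) ^ (c - 1) * Real.exp (-(X * (1 - t))) ≤
        (1 / X) ^ c * Real.Gamma c := by
  have hval := Real.integral_rpow_mul_exp_neg_mul_Ioi hc hX
  have hne : ∫ t : ℝ in Set.Ioi 0, t ^ (c - 1) * Real.exp (-(X * t)) ≠ 0 := by
    rw [hval]
    have := Real.Gamma_pos_of_pos hc
    positivity
  have hint : IntegrableOn (fun t : ℝ => t ^ (c - 1) * Real.exp (-(X * t))) (Set.Ioi 0) := by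
    -- A non-integrable function has Bochner integral `0`, so the nonzero Gamma value forces
    -- integrability.
    by_contra h
    exact hne (integral_undef h)
  have hsub : Set.Ioc (0 : ℝ) 1 ⊆ Set.Ioi 0 := fun t ht => ht.1
  have hII : IntervalIntegrable (fun t : ℝ => t ^ (c - 1) * Real.exp (-(X * t))) volume 0 1 :=
    (intervalIntegrable_iff_integrableOn_Ioc_of_le zero_le_one).mpr (hint.mono_set hsub)
  have hII' := (hII.comp_sub_left 1).symm
  simp only [sub_zero, sub_self] at hII'
  refine ⟨(intervalIntegrable_iff_integrableOn_Ioc_of_le zero_le_one).mp hII', ?_⟩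
  have hcv := intervalIntegral.integral_comp_sub_left (a := 0) (b := 1)
    (fun t : ℝ => t ^ (c - 1) * Real.exp (-(X * t))) 1
  rw [← intervalIntegral.integral_of_le zero_le_one, hcv, sub_self, sub_zero,
    intervalIntegral.integral_of_le zero_le_one, ← hval]
  refine setIntegral_mono_set hint ?_ hsub.eventuallyLE
  refine (ae_restrict_iff' measurableSet_Ioi).mpr (ae_of_all _ fun t ht => ?_)
  have : (0 : ℝ) < t := ht
  simp only [Pi.zero_apply]
  positivity

theorem rpow_sub_one_le_of_half_le (a : ℝ) {t : ℝ} (h1 : 1 / 2 ≤ t) (h2 : t ≤ 1) :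
    t ^ (a - 1) ≤ 2 ^ |a - 1| := by
  have ht : 0 < t := by linarith
  rcases le_total 0 (a - 1) with h | h
  · exact (Real.rpow_le_one ht.le h2 h).trans (Real.one_le_rpow (by norm_num) (abs_nonneg _))
  · rw [abs_of_nonpos h, Real.rpow_neg (by norm_num), ← Real.inv_rpow (by norm_num)]
    exact Real.rpow_le_rpow_of_nonpos (by norm_num) (by linarith) h

/-- The Beta integral against `exp (-(1 - t) x² / 2)` decays like `(1 + x)^{-2c}`. -/
theorem exists_integral_beta_mul_exp_le {a c : ℝ} (ha : 0 < a) (hc : 0 < c) :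
    ∃ C, 0 ≤ C ∧ ∀ x : ℝ, 0 ≤ x →
      ∫ t in Set.Ioc (0 : ℝ) 1, t ^ (a - 1) * (1 - t) ^ (c - 1) *
        Real.exp (-((1 - t) * x ^ 2 / 2)) ≤ C * (1 + x) ^ (-(2 * c)) := by
  set b := ∫ t in Set.Ioc (0 : ℝ) 1, t ^ (a - 1) * (1 - t) ^ (c - 1) with hb
  have hker : ∀ t ∈ Set.Ioc (0 : ℝ) 1, 0 ≤ t ^ (a - 1) * (1 - t) ^ (c - 1) := fun t ht =>
    mul_nonneg (Real.rpow_nonneg ht.1.le _) (Real.rpow_nonneg (by linarith [ht.2]) _)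
  have hb0 : 0 ≤ b := setIntegral_nonneg measurableSet_Ioc hker
  have hG := Real.Gamma_pos_of_pos hc
  obtain ⟨D, hD0, hD⟩ := exists_rpow_mul_exp_neg_sq_le 0 (2 * c) (a := 1 / 4) (by norm_num)
  refine ⟨b * 2 ^ (2 * c) + (2 ^ |a - 1| * (8 ^ c * Real.Gamma c) + D * b), by positivity,
    fun x hx => ?_⟩
  have h1x : (0 : ℝ) < 1 + x := by positivity
  have hnn : ∀ᵐ t ∂volume.restrict (Set.Ioc (0 : ℝ) 1), 0 ≤ t ^ (a - 1) * (1 - t) ^ (c - 1) *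
        Real.exp (-((1 - t) * x ^ 2 / 2)) :=
    (ae_restrict_iff' measurableSet_Ioc).mpr (ae_of_all _ fun t ht =>
      mul_nonneg (hker t ht) (Real.exp_pos _).le)
  -- For `x ≤ 1` the weight `(1+x)^{-2c}` is bounded below and the full Beta integral suffices.
  rcases le_total x 1 with hx1 | hx1
  · have h1 : ∫ t in Set.Ioc (0 : ℝ) 1, t ^ (a - 1) * (1 - t) ^ (c - 1) *
        Real.exp (-((1 - t) * x ^ 2 / 2)) ≤ b := by
      refine integral_mono_of_nonneg hnn (integrableOn_beta ha hc)
        ((ae_restrict_iff' measurableSet_Ioc).mpr (ae_of_all _ fun t ht => ?_))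
      refine mul_le_of_le_one_right (hker t ht) (Real.exp_le_one_iff.mpr ?_)
      have : 0 ≤ 1 - t := by linarith [ht.2]
      have : 0 ≤ (1 - t) * x ^ 2 / 2 := by positivity
      linarith
    have h2 : 1 ≤ 2 ^ (2 * c) * (1 + x) ^ (-(2 * c)) := by
      rw [Real.rpow_neg h1x.le, ← div_eq_mul_inv, one_le_div (by positivity)]
      exact Real.rpow_le_rpow h1x.le (by linarith) (by positivity)
    have h3 : 0 ≤ (2 ^ |a - 1| * (8 ^ c * Real.Gamma c) + D * b) * (1 + x) ^ (-(2 * c)) := by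
      positivity
    nlinarith [mul_le_mul_of_nonneg_left h2 hb0]
  · set X := x ^ 2 / 2 with hX
    have hXpos : 0 < X := by positivity
    obtain ⟨hi, hle⟩ := integrableOn_and_integral_one_sub_rpow_mul_exp_le hc hXpos
    have h1 : ∫ t in Set.Ioc (0 : ℝ) 1, t ^ (a - 1) * (1 - t) ^ (c - 1) *
        Real.exp (-((1 - t) * x ^ 2 / 2)) ≤
        ∫ t in Set.Ioc (0 : ℝ) 1,
          (2 ^ |a - 1| * ((1 - t) ^ (c - 1) * Real.exp (-(X * (1 - t)))) +
            Real.exp (-(1 / 4 * x ^ 2)) * (t ^ (a - 1) * (1 - t) ^ (c - 1))) := by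
      refine integral_mono_of_nonneg hnn ((hi.const_mul _).add
        ((integrableOn_beta ha hc).const_mul _))
        ((ae_restrict_iff' measurableSet_Ioc).mpr (ae_of_all _ fun t ht => ?_))
      have h1t : 0 ≤ 1 - t := by linarith [ht.2]
      have e : (1 - t) * x ^ 2 / 2 = X * (1 - t) := by rw [hX]; ring
      have hA : 0 ≤ (1 - t) ^ (c - 1) * Real.exp (-(X * (1 - t))) := by positivity
      have hB := hker t ht
      simp only [e]
      -- Near `t = 1` the factor `t^{a-1}` is bounded and a Gamma integral remains; for `t ≤ 1/2`
      -- the exponential is at most `exp(-x²/4)` and absorbs any power of `x`.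
      rcases le_total (1 / 2) t with h | h
      · have h2 := mul_le_mul_of_nonneg_right (rpow_sub_one_le_of_half_le a h ht.2) hA
        have h3 : 0 ≤ Real.exp (-(1 / 4 * x ^ 2)) * (t ^ (a - 1) * (1 - t) ^ (c - 1)) := by
          positivity
        linarith
      · have h2 : Real.exp (-(X * (1 - t))) ≤ Real.exp (-(1 / 4 * x ^ 2)) := by
          rw [Real.exp_le_exp, hX]
          nlinarith [sq_nonneg x]
        have h3 := mul_le_mul_of_nonneg_left h2 hB
        have h4 : 0 ≤ 2 ^ |a - 1| * ((1 - t) ^ (c - 1) * Real.exp (-(X * (1 - t)))) := by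
          positivity
        linarith
    rw [integral_add (hi.const_mul _) ((integrableOn_beta ha hc).const_mul _),
      integral_const_mul, integral_const_mul, ← hb] at h1
    -- Since `1 + x ≤ 2x`, one has `1/X = 2/x² ≤ 8/(1+x)²`.
    have h2 : (1 / X) ^ c ≤ 8 ^ c * (1 + x) ^ (-(2 * c)) := by
      have e : (1 + x) ^ (-(2 * c)) = (((1 + x) ^ 2)⁻¹) ^ c := by
        rw [Real.rpow_neg h1x.le, Real.inv_rpow (by positivity), ← Real.rpow_natCast,
          ← Real.rpow_mul h1x.le]
        norm_num
      rw [e, ← Real.mul_rpow (by norm_num) (by positivity)]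
      refine Real.rpow_le_rpow (by positivity) ?_ hc.le
      rw [hX, ← div_eq_mul_inv, div_le_div_iff₀ (by positivity) (by positivity)]
      nlinarith
    have h3 := hD x hx
    rw [Real.rpow_zero, one_mul] at h3
    have h4 : 0 ≤ b * 2 ^ (2 * c) * (1 + x) ^ (-(2 * c)) := by positivity
    have h5 : 2 ^ |a - 1| * ∫ t in Set.Ioc (0 : ℝ) 1,
        (1 - t) ^ (c - 1) * Real.exp (-(X * (1 - t))) ≤
        2 ^ |a - 1| * (8 ^ c * (1 + x) ^ (-(2 * c)) * Real.Gamma c) := by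
      gcongr
      exact hle.trans (by gcongr)
    have h6 := mul_le_mul_of_nonneg_right h3 hb0
    linarith

/-! ### Gamma quotients as multipliers -/

/-- The multiplier `Γ(a + k) / Γ(b + k)` for `k ≥ K`. -/
noncomputable def gammaRatio (K : ℕ) (a b : ℝ) (k : ℕ) : ℝ :=
  if K ≤ k then Real.Gamma (a + k) / Real.Gamma (b + k) else 0

/-- Ratio test: consecutive quotients are `(a+k)/(b+k)`, which tend to `1`, times `1/2`. -/
theorem slowGrowth_gammaRatio {K : ℕ} {a b : ℝ} (ha : 0 < a + K) (hb : 0 < b + K) :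
    SlowGrowth (gammaRatio K a b) := by
  have hpos : ∀ {x : ℝ} {k : ℕ}, 0 < x + K → K ≤ k → 0 < x + k := fun hx hk => by
    have : (K : ℝ) ≤ (_ : ℕ) := Nat.cast_le.mpr hk
    linarith
  refine summable_of_ratio_test_tendsto_lt_one (l := 1 / 2) (by norm_num) ?_ ?_
  · filter_upwards [Filter.eventually_ge_atTop K] with k hk
    have h1 := Real.Gamma_pos_of_pos (hpos ha hk)
    have h2 := Real.Gamma_pos_of_pos (hpos hb hk)
    rw [gammaRatio, if_pos hk]
    positivity
  · have hlim : Filter.Tendsto (fun k : ℕ => ((a + k) / (b + k)) * (1 / 2 : ℝ)) Filter.atTop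
        (nhds (1 * (1 / 2))) := by
      refine Filter.Tendsto.mul_const _ ?_
      have h1 := tendsto_add_mul_div_add_mul_atTop_nhds a b (1 : ℝ) (d := 1) one_ne_zero
      simpa using h1
    rw [one_mul] at hlim
    refine hlim.congr' ?_
    filter_upwards [Filter.eventually_ge_atTop K] with k hk
    have ha' := hpos ha hk
    have hb' := hpos hb hk
    have h1 := Real.Gamma_pos_of_pos ha'
    have h2 := Real.Gamma_pos_of_pos hb'
    have e1 : Real.Gamma (a + (k + 1 : ℕ)) = (a + k) * Real.Gamma (a + k) := by
      rw [← Real.Gamma_add_one ha'.ne']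
      push_cast
      ring_nf
    have e2 : Real.Gamma (b + (k + 1 : ℕ)) = (b + k) * Real.Gamma (b + k) := by
      rw [← Real.Gamma_add_one hb'.ne']
      push_cast
      ring_nf
    rw [gammaRatio, gammaRatio, if_pos hk, if_pos (hk.trans k.le_succ), e1, e2,
      Real.norm_of_nonneg (by positivity), Real.norm_of_nonneg (by positivity),
      abs_of_pos (by positivity), abs_of_pos (by positivity), pow_succ]
    field_simp

/-! ### Pointwise bounds for homogeneous parts and for the radial derivative -/

theorem norm_eq_gaussMod_mul {n : ℕ} (f : Cn n → ℂ) (z : Cn n) :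
    ‖f z‖ = gaussMod f z * Real.exp (‖z‖ ^ 2 / 2) := by
  rw [gaussMod, mul_assoc, ← Real.exp_add, neg_div, neg_add_cancel, Real.exp_zero, mul_one]

theorem nonneg_of_gaussMod_mul_le {n : ℕ} {f : Cn n → ℂ} {γ B : ℝ}
    (hB : ∀ w, gaussMod f w * (1 + ‖w‖) ^ γ ≤ B) : 0 ≤ B :=
  (mul_nonneg (gaussMod_nonneg f 0) (by positivity)).trans (hB 0)

theorem gaussMod_le_of_gaussMod_mul_le {n : ℕ} {f : Cn n → ℂ} {γ B : ℝ}
    (hB : ∀ w, gaussMod f w * (1 + ‖w‖) ^ γ ≤ B) (w : Cn n) :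
    gaussMod f w ≤ B * (1 + ‖w‖) ^ |γ| := by
  have h1 : (0 : ℝ) < 1 + ‖w‖ := by positivity
  have hB0 := nonneg_of_gaussMod_mul_le hB
  have h2 : gaussMod f w ≤ B * (1 + ‖w‖) ^ (-γ) := by
    rw [Real.rpow_neg h1.le, ← div_eq_mul_inv, le_div_iff₀ (by positivity)]
    exact hB w
  refine h2.trans (mul_le_mul_of_nonneg_left ?_ hB0)
  exact Real.rpow_le_rpow_of_exponent_le (by linarith [norm_nonneg w]) (neg_le_abs γ)

theorem norm_le_of_gaussMod_mul_le {n : ℕ} {f : Cn n → ℂ} {γ B : ℝ}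
    (hB : ∀ w, gaussMod f w * (1 + ‖w‖) ^ γ ≤ B) {w : Cn n} {r : ℝ} (hw : ‖w‖ ≤ r) :
    ‖f w‖ ≤ B * (1 + r) ^ |γ| * Real.exp (r ^ 2 / 2) := by
  have hB0 := nonneg_of_gaussMod_mul_le hB
  rw [norm_eq_gaussMod_mul]
  have h0 := norm_nonneg w
  have h1 : gaussMod f w ≤ B * (1 + r) ^ |γ| := by
    refine (gaussMod_le_of_gaussMod_mul_le hB w).trans ?_
    gcongr
  have h2 : ‖w‖ ^ 2 ≤ r ^ 2 := by gcongr
  have hr : 0 ≤ r := h0.trans hw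
  refine mul_le_mul h1 ?_ (Real.exp_pos _).le (by positivity)
  gcongr

theorem norm_homPart_le_of_norm_le {n : ℕ} {f : Cn n → ℂ} (hf : f ∈ Entire n) {S : ℝ}
    (hS : ∀ w, ‖w‖ ≤ 1 → ‖f w‖ ≤ S) (k : ℕ) (z : Cn n) :
    ‖homPart f k z‖ ≤ S * (1 + ‖z‖) ^ k := by
  have hz : (0 : ℝ) < 1 + ‖z‖ := by positivity
  have := norm_homPart_mul_pow_le hf k z (r := (1 + ‖z‖)⁻¹) (S := S) (by positivity)
    (fun t ht => hS _ (by
      rw [norm_smul, ht, inv_mul_le_iff₀ hz]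
      linarith))
  rwa [inv_pow, ← div_eq_mul_inv, div_le_iff₀ (by positivity)] at this

/-- The global bound `B` controls `f` on the unit ball, hence the coefficients of `f_k`; a
polynomial against the Gaussian decays faster than any power, so both weights are arbitrary. -/
theorem exists_gaussMod_homPart_le (n k : ℕ) (γ γ' M : ℝ) :
    ∃ C, 0 ≤ C ∧ ∀ f ∈ Entire n, ∀ B, (∀ w, gaussMod f w * (1 + ‖w‖) ^ γ ≤ B) →
      ∀ z, gaussMod (homPart f k) z * (1 + ‖z‖) ^ γ' ≤ C * ((1 + ‖z‖) ^ (-M) * B) := by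
  obtain ⟨D, hD0, hD⟩ := exists_rpow_mul_exp_neg_sq_le (k + γ') M (a := 1 / 2) (by norm_num)
  refine ⟨2 ^ |γ| * Real.exp (1 / 2) * D, by positivity, fun f hf B hB z => ?_⟩
  have hB0 := nonneg_of_gaussMod_mul_le hB
  have hz : (0 : ℝ) < 1 + ‖z‖ := by positivity
  set S := B * 2 ^ |γ| * Real.exp (1 / 2) with hS
  have hS0 : 0 ≤ S := by positivity
  have h1 : ‖homPart f k z‖ ≤ S * (1 + ‖z‖) ^ k :=
    norm_homPart_le_of_norm_le hf (fun w hw => by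
      have := norm_le_of_gaussMod_mul_le hB hw
      norm_num at this
      rw [hS]
      norm_num
      exact this) k z
  have h2 := hD ‖z‖ (norm_nonneg z)
  rw [Real.rpow_add hz, Real.rpow_natCast] at h2
  have e : -‖z‖ ^ 2 / 2 = -(1 / 2 * ‖z‖ ^ 2) := by ring
  rw [gaussMod, e]
  calc ‖homPart f k z‖ * Real.exp (-(1 / 2 * ‖z‖ ^ 2)) * (1 + ‖z‖) ^ γ'
      ≤ (S * (1 + ‖z‖) ^ k) * Real.exp (-(1 / 2 * ‖z‖ ^ 2)) * (1 + ‖z‖) ^ γ' := by gcongr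
    _ = S * ((1 + ‖z‖) ^ k * (1 + ‖z‖) ^ γ' * Real.exp (-(1 / 2 * ‖z‖ ^ 2))) := by ring
    _ ≤ S * (D * (1 + ‖z‖) ^ (-M)) := mul_le_mul_of_nonneg_left h2 hS0
    _ = _ := by rw [hS]; ring

theorem slowGrowth_natCast_add (b : ℝ) : SlowGrowth fun k => k + b := by
  have h1 : Summable fun k : ℕ => (k : ℝ) ^ 1 * (1 / 2 : ℝ) ^ k :=
    summable_pow_mul_geometric_of_norm_lt_one 1 (by norm_num)
  have h2 : Summable fun k : ℕ => |b| * (1 / 2 : ℝ) ^ k := summable_geometric_two.mul_left _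
  refine Summable.of_nonneg_of_le (fun k => by positivity) (fun k => ?_) (h1.add h2)
  rw [pow_one, ← add_mul]
  refine mul_le_mul_of_nonneg_right ?_ (by positivity)
  simpa using abs_add_le (k : ℝ) b

/-- The multiplier `k + b` is the operator `f ↦ R f + b f`, with `R` the radial derivative. -/
theorem multiplier_natCast_add {n : ℕ} {f : Cn n → ℂ} (hf : f ∈ Entire n) (b : ℝ) (z : Cn n) :
    multiplier (fun k => k + b) f z = deriv (fun t : ℂ => f (t • z)) 1 + b * f z := by
  set g : ℂ → ℂ := fun t => f (t • z) with hg
  have hgd : Differentiable ℂ g := differentiable_slice hf z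
  have h1 := Complex.hasSum_taylorSeries_of_entire hgd.deriv 0 1
  -- The term `k = 0` vanishes, and the shifted series is the Taylor series of `g'` at the point
  -- `1`.
  have h2 : HasSum (fun k : ℕ => (k : ℂ) * homPart f k z) (deriv g 1) := by
    rw [← hasSum_nat_add_iff' 1]
    simp only [Finset.range_one, Finset.sum_singleton, Nat.cast_zero, zero_mul, sub_zero]
    convert h1 using 2 with k
    have hk : (k.factorial : ℂ) ≠ 0 := by exact_mod_cast k.factorial_ne_zero
    have hk1 : ((k : ℂ) + 1) ≠ 0 := by exact_mod_cast k.succ_ne_zero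
    rw [homPart, ← iteratedDeriv_succ', Nat.factorial_succ]
    simp only [sub_zero, one_pow, smul_eq_mul, one_mul, Nat.cast_mul, Nat.cast_add, Nat.cast_one]
    field_simp
    rfl
  refine (hasSum_multiplier (slowGrowth_natCast_add b) hf z).unique ?_
  convert h2.add ((hasSum_homPart hf z).mul_left (b : ℂ)) using 2 with k
  push_cast
  ring

/-- A Cauchy estimate on the slice `t ↦ f(tz)` over the circle `|t - 1| = 1/(1+|z|)`, which stays
within distance `1` of `z`. The loss `(1+|z|)²` comes from differentiating the Gaussian factor; the
Cauchy estimate itself costs only `1+|z|`. -/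
theorem gaussMod_multiplier_natCast_add_le {n : ℕ} {f : Cn n → ℂ} (hf : f ∈ Entire n) (b : ℝ)
    {z : Cn n} {S : ℝ} (hS : ∀ w, ‖w - z‖ ≤ 1 → gaussMod f w ≤ S) :
    gaussMod (multiplier (fun k => k + b) f) z ≤
      (1 + |b| + Real.exp (1 / 2)) * ((1 + ‖z‖) ^ 2 * S) := by
  have hSz : gaussMod f z ≤ S := hS z (by simp)
  have hS0 : 0 ≤ S := (gaussMod_nonneg f z).trans hSz
  set x := ‖z‖ with hx
  have hx0 : 0 ≤ x := norm_nonneg z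
  set g : ℂ → ℂ := fun t => f (t • z) with hg
  have hgd : Differentiable ℂ g := differentiable_slice hf z
  -- In `|t|² = 1 + 2 Re(t-1) + |t-1|²` the twist cancels the linear term, which could reach size
  -- about `x` in the exponent; the quadratic one contributes at most `exp(1/2)` because `|t-1| x ≤
  -- 1`.
  set G : ℂ → ℂ := fun t => g t * Complex.exp (-((t - 1) * (x ^ 2 : ℝ))) with hG
  have hGd : Differentiable ℂ G := by fun_prop
  have hder : deriv G 1 = deriv g 1 - (x ^ 2 : ℝ) * f z := by
    have h1 : HasDerivAt (fun t : ℂ => Complex.exp (-((t - 1) * (x ^ 2 : ℝ))))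
        (Complex.exp (-((1 - 1) * (x ^ 2 : ℝ))) * (-(1 * (x ^ 2 : ℝ)))) 1 :=
      ((((hasDerivAt_id (1 : ℂ)).sub_const 1).mul_const _).neg).cexp
    have h2 := ((hgd 1).hasDerivAt.mul h1).deriv
    have h3 : deriv G 1 = _ := h2
    rw [h3]
    simp [hg]
    ring
  have hGle : ‖deriv G 1‖ ≤ S * (Real.exp (x ^ 2 / 2) * Real.exp (1 / 2)) / (1 + x)⁻¹ := by
    refine Complex.norm_deriv_le_of_forall_mem_sphere_norm_le (by positivity)
      hGd.diffContOnCl fun t ht => ?_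
    have ht' : ‖t - 1‖ = (1 + x)⁻¹ := by simpa using ht
    have htx : ‖t - 1‖ * x ≤ 1 := by
      rw [ht', inv_mul_le_iff₀ (by positivity)]
      linarith
    have hw : gaussMod f (t • z) ≤ S := by
      refine hS _ ?_
      have : t • z - z = (t - 1) • z := by rw [sub_smul, one_smul]
      rwa [this, norm_smul]
    have hsq : ‖t‖ ^ 2 = 1 + 2 * (t - 1).re + ‖t - 1‖ ^ 2 := by
      rw [← Complex.normSq_eq_norm_sq, ← Complex.normSq_eq_norm_sq, Complex.normSq_apply,
        Complex.normSq_apply]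
      simp
      ring
    have hre : (-((t - 1) * ((x ^ 2 : ℝ) : ℂ))).re = -((t - 1).re * x ^ 2) := by
      rw [Complex.neg_re, Complex.re_mul_ofReal]
    rw [hG, norm_mul, Complex.norm_exp, hre, hg]
    simp only
    rw [norm_eq_gaussMod_mul, mul_assoc]
    refine mul_le_mul hw ?_ (by positivity) hS0
    rw [← Real.exp_add, ← Real.exp_add, Real.exp_le_exp, norm_smul, mul_pow, hsq, ← hx]
    have : (‖t - 1‖ * x) ^ 2 ≤ 1 := pow_le_one₀ (by positivity) htx
    nlinarith
  have hEE : Real.exp (x ^ 2 / 2) * Real.exp (-x ^ 2 / 2) = 1 := by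
    rw [← Real.exp_add, neg_div, add_neg_cancel, Real.exp_zero]
  have hfz : ‖f z‖ ≤ S * Real.exp (x ^ 2 / 2) := by
    rw [norm_eq_gaussMod_mul]
    gcongr
  have hnorm : ‖multiplier (fun k => k + b) f z‖ ≤
      (1 + |b| + Real.exp (1 / 2)) * ((1 + x) ^ 2 * S) * Real.exp (x ^ 2 / 2) := by
    have e : multiplier (fun k => k + b) f z =
        deriv G 1 + ((x ^ 2 : ℝ) * f z + b * f z) := by
      rw [multiplier_natCast_add hf b z, hder]
      ring
    have h1 : ‖((x ^ 2 : ℝ) : ℂ) * f z + b * f z‖ ≤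
        (x ^ 2 + |b|) * (S * Real.exp (x ^ 2 / 2)) := by
      refine (norm_add_le _ _).trans ?_
      rw [norm_mul, norm_mul, Complex.norm_real, Complex.norm_real,
        Real.norm_of_nonneg (by positivity), Real.norm_eq_abs, ← add_mul]
      gcongr
    rw [div_inv_eq_mul] at hGle
    have h2 : x ^ 2 ≤ (1 + x) ^ 2 := by nlinarith
    have h3 : 1 ≤ (1 + x) ^ 2 := by nlinarith
    have h4 : 1 + x ≤ (1 + x) ^ 2 := by nlinarith
    have h5 : x ^ 2 + |b| + Real.exp (1 / 2) * (1 + x) ≤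
        (1 + |b| + Real.exp (1 / 2)) * (1 + x) ^ 2 := by
      nlinarith [mul_le_mul_of_nonneg_left h3 (abs_nonneg b),
        mul_le_mul_of_nonneg_left h4 (Real.exp_pos (1 / 2)).le]
    rw [e]
    refine (norm_add_le _ _).trans ((add_le_add hGle h1).trans ?_)
    calc S * (Real.exp (x ^ 2 / 2) * Real.exp (1 / 2)) * (1 + x) +
          (x ^ 2 + |b|) * (S * Real.exp (x ^ 2 / 2))
        = (x ^ 2 + |b| + Real.exp (1 / 2) * (1 + x)) * (S * Real.exp (x ^ 2 / 2)) := by ring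
      _ ≤ (1 + |b| + Real.exp (1 / 2)) * (1 + x) ^ 2 * (S * Real.exp (x ^ 2 / 2)) := by gcongr
      _ = _ := by ring
  rw [gaussMod, ← hx]
  refine (mul_le_mul_of_nonneg_right hnorm (Real.exp_pos _).le).trans (le_of_eq ?_)
  rw [mul_assoc, hEE, mul_one]

/-! ### Pointwise bounds for fractional integration -/

/-- Expanding each coefficient as a Beta integral and summing under the integral recovers `f(tz)`.
Vanishing to order `K` removes the degrees whose Beta integral may diverge at `0`; the factor `t^K`
in `hb` serves the same purpose for the majorant. -/
theorem norm_multiplier_gammaRatio_le {n K : ℕ} {a c : ℝ} (ha : 0 < a + K) (hc : 0 < c)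
    {f : Cn n → ℂ} (hf : f ∈ Entire n) (hlow : ∀ k < K, ∀ z, homPart f k z = 0) (z : Cn n)
    {φ : ℝ → ℝ}
    (hφ : IntegrableOn (fun t => t ^ (a + K - 1) * (1 - t) ^ (c - 1) * φ t) (Set.Ioc 0 1))
    (hb : ∀ t ∈ Set.Ioc (0 : ℝ) 1, ‖f ((t : ℂ) • z)‖ ≤ t ^ K * φ t) :
    ‖multiplier (gammaRatio K a (a + c)) f z‖ ≤
      (Real.Gamma c)⁻¹ * ∫ t in Set.Ioc (0 : ℝ) 1, t ^ (a + K - 1) * (1 - t) ^ (c - 1) * φ t := by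
  have hG := Real.Gamma_pos_of_pos hc
  have hak : ∀ {k : ℕ}, K ≤ k → 0 < a + k := fun hk => by
    have : (K : ℝ) ≤ (_ : ℕ) := Nat.cast_le.mpr hk
    linarith
  have hsg : SlowGrowth (gammaRatio K a (a + c)) := slowGrowth_gammaRatio ha (by linarith)
  set F : ℕ → ℝ → ℂ := fun k t =>
    if K ≤ k then ((t ^ (a + k - 1) * (1 - t) ^ (c - 1) : ℝ) : ℂ) * homPart f k z else 0 with hF
  have hFint : ∀ k, IntegrableOn (F k) (Set.Ioc 0 1) := by
    intro k
    by_cases hk : K ≤ k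
    · simp only [hF, if_pos hk]
      exact (integrableOn_beta (hak hk) hc).ofReal.mul_const _
    · simp only [hF, if_neg hk]
      exact integrableOn_zero
  have hval : ∀ k, ∫ t in Set.Ioc (0 : ℝ) 1, F k t =
      (Real.Gamma c : ℂ) * ((gammaRatio K a (a + c) k : ℂ) * homPart f k z) := by
    intro k
    by_cases hk : K ≤ k
    · simp only [hF, if_pos hk, gammaRatio]
      rw [integral_mul_const, integral_complex_ofReal, integral_beta (hak hk) hc,
        show a + k + c = a + c + k by ring]
      push_cast
      ring
    · simp [hF, if_neg hk, gammaRatio]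
  have hnval : ∀ k, ∫ t in Set.Ioc (0 : ℝ) 1, ‖F k t‖ =
      Real.Gamma c * ‖(gammaRatio K a (a + c) k : ℂ) * homPart f k z‖ := by
    intro k
    by_cases hk : K ≤ k
    · have h1 := Real.Gamma_pos_of_pos (hak hk)
      have h2 : 0 < Real.Gamma (a + c + k) :=
        Real.Gamma_pos_of_pos (by have := hak hk; linarith)
      have : ∫ t in Set.Ioc (0 : ℝ) 1, ‖F k t‖ = ∫ t in Set.Ioc (0 : ℝ) 1,
          (t ^ (a + k - 1) * (1 - t) ^ (c - 1)) * ‖homPart f k z‖ := by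
        refine setIntegral_congr_fun measurableSet_Ioc fun t ht => ?_
        simp only [hF, if_pos hk]
        rw [norm_mul, Complex.norm_real, Real.norm_of_nonneg (mul_nonneg
          (Real.rpow_nonneg ht.1.le _) (Real.rpow_nonneg (by linarith [ht.2]) _))]
      rw [this, integral_mul_const, integral_beta (hak hk) hc, gammaRatio, if_pos hk, norm_mul,
        Complex.norm_real, Real.norm_of_nonneg (by positivity),
        show a + k + c = a + c + k by ring]
      ring
    · simp [hF, if_neg hk, gammaRatio]
  -- The interchange is legitimate because the `L¹` norms of the terms are `Γ(c)` times the terms of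
  -- an absolutely convergent multiplier series.
  have hsum := hasSum_integral_of_summable_integral_norm hFint (by
    simp only [hnval]
    exact (summable_norm_multiplier hsg hf z).mul_left _)
  simp only [hval] at hsum
  have hT : (Real.Gamma c : ℂ) * multiplier (gammaRatio K a (a + c)) f z =
      ∫ t in Set.Ioc (0 : ℝ) 1, ∑' k, F k t :=
    ((hasSum_multiplier hsg hf z).mul_left _).unique hsum
  have hpt : ∀ t ∈ Set.Ioc (0 : ℝ) 1,
      ∑' k, F k t = ((t ^ (a - 1) * (1 - t) ^ (c - 1) : ℝ) : ℂ) * f ((t : ℂ) • z) := by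
    intro t ht
    refine HasSum.tsum_eq ?_
    suffices e : (fun k => F k t) = fun k =>
        ((t ^ (a - 1) * (1 - t) ^ (c - 1) : ℝ) : ℂ) * homPart f k ((t : ℂ) • z) by
      rw [e]
      exact (hasSum_homPart hf ((t : ℂ) • z)).mul_left _
    ext k
    by_cases hk : K ≤ k
    · simp only [hF, if_pos hk]
      rw [homPart_smul hf, show a + k - 1 = (a - 1) + k by ring, Real.rpow_add ht.1,
        Real.rpow_natCast]
      push_cast
      ring
    · simp only [hF, if_neg hk]
      rw [hlow k (not_le.mp hk), mul_zero]
  have hle : ‖∫ t in Set.Ioc (0 : ℝ) 1, ∑' k, F k t‖ ≤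
      ∫ t in Set.Ioc (0 : ℝ) 1, t ^ (a + K - 1) * (1 - t) ^ (c - 1) * φ t := by
    refine norm_integral_le_of_norm_le hφ
      ((ae_restrict_iff' measurableSet_Ioc).mpr (ae_of_all _ fun t ht => ?_))
    have h1 : 0 ≤ t ^ (a - 1) * (1 - t) ^ (c - 1) := mul_nonneg
      (Real.rpow_nonneg ht.1.le _) (Real.rpow_nonneg (by linarith [ht.2]) _)
    rw [hpt t ht, norm_mul, Complex.norm_real, Real.norm_of_nonneg h1]
    refine (mul_le_mul_of_nonneg_left (hb t ht) h1).trans (le_of_eq ?_)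
    rw [show a + K - 1 = (a - 1) + K by ring, Real.rpow_add ht.1, Real.rpow_natCast]
    ring
  rw [← hT, norm_mul, Complex.norm_real, Real.norm_of_nonneg hG.le] at hle
  rwa [le_inv_mul_iff₀ hG]

/-- A Schwarz-type bound: Cauchy on radius `1/2` gives `|f_k(z)| ≤ 2^k S`, and for `t ≤ 1/4` the
series over `k ≥ K` is dominated by a geometric one after extracting `t^K`. -/
theorem norm_smul_le_of_homPart_eq_zero {n K : ℕ} {f : Cn n → ℂ} (hf : f ∈ Entire n)
    (hlow : ∀ k < K, ∀ z, homPart f k z = 0) {z : Cn n} {S : ℝ}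
    (hS : ∀ t : ℂ, ‖t‖ = 1 / 2 → ‖f (t • z)‖ ≤ S) {t : ℝ} (ht0 : 0 ≤ t) (ht : t ≤ 1 / 4) :
    ‖f ((t : ℂ) • z)‖ ≤ t ^ K * (4 ^ K * 2 * S) := by
  have hS0 : 0 ≤ S := (norm_nonneg _).trans (hS (1 / 2) (by simp))
  have h1 := hasSum_homPart hf ((t : ℂ) • z)
  have h2 : HasSum (fun k : ℕ => t ^ K * (4 ^ K * S) * (1 / 2 : ℝ) ^ k)
      (t ^ K * (4 ^ K * S) * 2) := hasSum_geometric_two.mul_left _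
  rw [← h1.tsum_eq]
  refine (tsum_of_norm_bounded h2 fun k => ?_).trans (le_of_eq (by ring))
  by_cases hk : K ≤ k
  · have h3 := norm_homPart_mul_pow_le hf k z (r := 1 / 2) (by norm_num) hS
    rw [homPart_smul hf, norm_mul, norm_pow, Complex.norm_real, Real.norm_of_nonneg ht0]
    obtain ⟨j, rfl⟩ := Nat.exists_eq_add_of_le hk
    have h4 : t ^ j ≤ (1 / 4) ^ j := pow_le_pow_left₀ ht0 ht j
    have h5 : ‖homPart f (K + j) z‖ ≤ S * 2 ^ (K + j) := by
      rwa [one_div, inv_pow, ← div_eq_mul_inv, div_le_iff₀ (by positivity)] at h3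
    calc t ^ (K + j) * ‖homPart f (K + j) z‖
        ≤ t ^ (K + j) * (S * 2 ^ (K + j)) := by gcongr
      _ = t ^ K * S * 2 ^ (K + j) * t ^ j := by ring
      _ ≤ t ^ K * S * 2 ^ (K + j) * (1 / 4) ^ j := by gcongr
      _ = t ^ K * (4 ^ K * S) * (1 / 2) ^ (K + j) := by
          have e : (4 : ℝ) = 2 * 2 := by norm_num
          rw [e]
          simp only [one_div, mul_inv, mul_pow, inv_pow, pow_add]
          field_simp
  · rw [hlow k (not_le.mp hk), norm_zero]
    positivity

/-- Three regimes. For `t ≤ 1/4` the vanishing order supplies `t^K` and the Gaussian surplus is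
huge; for larger `t` with `(1-t)|z| ≤ 1` the point `tz` lies in the unit ball about `z`; otherwise
`exp(-(1-t)|z|²/2) ≤ exp(-|z|/2)` is rapidly decreasing. -/
theorem exists_norm_smul_le_radial (n K : ℕ) (γ M : ℝ) :
    ∃ D, 0 ≤ D ∧ ∀ f ∈ Entire n, (∀ k < K, ∀ z, homPart f k z = 0) → ∀ z S B,
      (∀ w, ‖w - z‖ ≤ 1 → gaussMod f w ≤ S) → (∀ w, gaussMod f w * (1 + ‖w‖) ^ γ ≤ B) →
      ∀ t ∈ Set.Ioc (0 : ℝ) 1, ‖f ((t : ℂ) • z)‖ ≤ t ^ K * (D * Real.exp (‖z‖ ^ 2 / 2) *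
        (Real.exp (-((1 - t) * ‖z‖ ^ 2 / 2)) * S + (1 + ‖z‖) ^ (-M) * B)) := by
  obtain ⟨D₁, hD₁0, hD₁⟩ := exists_rpow_mul_exp_neg_le |γ| M (a := 1 / 2) (by norm_num)
  -- `3/8 = 1/2 - 1/8`: on the circle `|u| = 1/2` the growth of `f` is governed by `exp(x²/8)`
  -- instead of `exp(x²/2)`.
  obtain ⟨D₂, hD₂0, hD₂⟩ := exists_rpow_mul_exp_neg_sq_le |γ| M (a := 3 / 8) (by norm_num)
  refine ⟨4 ^ K * (1 + D₁) + 4 ^ K * 2 * D₂, by positivity, fun f hf hlow z S B hS hB t ht => ?_⟩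
  have hB0 := nonneg_of_gaussMod_mul_le hB
  have hS0 : 0 ≤ S := (gaussMod_nonneg f z).trans (hS z (by simp))
  have ht0 := ht.1
  have h1t : 0 ≤ 1 - t := by linarith [ht.2]
  set x := ‖z‖ with hx
  have hx0 : 0 ≤ x := norm_nonneg z
  have htz : ‖(t : ℂ) • z‖ = t * x := by
    rw [norm_smul, Complex.norm_real, Real.norm_of_nonneg ht0.le]
  set E := Real.exp (x ^ 2 / 2) with hE
  have hE0 : 0 < E := Real.exp_pos _
  set P := Real.exp (-((1 - t) * x ^ 2 / 2)) with hP
  have hP0 : 0 < P := Real.exp_pos _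
  set Q := (1 + x) ^ (-M) * B with hQ
  have hQ0 : 0 ≤ Q := by positivity
  rcases le_total t (1 / 4) with h4 | h4
  · have h1 := norm_smul_le_of_homPart_eq_zero hf hlow (z := z)
      (S := B * (1 + x) ^ |γ| * Real.exp (x ^ 2 / 8)) (fun u hu => by
        have hu' : ‖u • z‖ ≤ x / 2 := by
          rw [norm_smul, hu]
          linarith
        refine (norm_le_of_gaussMod_mul_le hB hu').trans ?_
        have e : (x / 2) ^ 2 / 2 = x ^ 2 / 8 := by ring
        rw [e]
        gcongr
        linarith) ht0.le h4
    refine h1.trans (mul_le_mul_of_nonneg_left ?_ (by positivity))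
    have h2 := hD₂ x hx0
    have h3 : Real.exp (x ^ 2 / 8) = E * Real.exp (-(3 / 8 * x ^ 2)) := by
      rw [hE, ← Real.exp_add]
      ring_nf
    calc 4 ^ K * 2 * (B * (1 + x) ^ |γ| * Real.exp (x ^ 2 / 8))
        = 4 ^ K * 2 * B * E * ((1 + x) ^ |γ| * Real.exp (-(3 / 8 * x ^ 2))) := by rw [h3]; ring
      _ ≤ 4 ^ K * 2 * B * E * (D₂ * (1 + x) ^ (-M)) := by gcongr
      _ = 4 ^ K * 2 * D₂ * E * Q := by rw [hQ]; ring
      _ ≤ (4 ^ K * (1 + D₁) + 4 ^ K * 2 * D₂) * E * (P * S + Q) := by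
          gcongr
          · have : 0 ≤ (4 : ℝ) ^ K * (1 + D₁) := by positivity
            linarith
          · have : 0 ≤ P * S := by positivity
            linarith
  -- `P * E = exp(t x²/2)`, and `t² ≤ t`.
  · have hgap : ‖f ((t : ℂ) • z)‖ ≤ gaussMod f ((t : ℂ) • z) * P * E := by
      rw [norm_eq_gaussMod_mul, mul_assoc, htz]
      refine mul_le_mul_of_nonneg_left ?_ (gaussMod_nonneg _ _)
      rw [hP, hE, ← Real.exp_add, Real.exp_le_exp]
      nlinarith [mul_nonneg h1t ht0.le, sq_nonneg x, mul_nonneg (mul_nonneg h1t ht0.le) (sq_nonneg x)]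
    have hmain : gaussMod f ((t : ℂ) • z) * P ≤ (1 + D₁) * (P * S + Q) := by
      rcases le_total ((1 - t) * x) 1 with h | h
      · have h2 : gaussMod f ((t : ℂ) • z) ≤ S := by
          refine hS _ ?_
          have e : (t : ℂ) • z - z = (((t - 1 : ℝ)) : ℂ) • z := by
            push_cast
            rw [sub_smul, one_smul]
          rw [e, norm_smul, Complex.norm_real, Real.norm_eq_abs, abs_sub_comm, abs_of_nonneg h1t]
          exact h
        have h3 : gaussMod f ((t : ℂ) • z) * P ≤ S * P := by gcongr
        have h4 : 0 ≤ D₁ * (P * S + Q) := by positivity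
        linarith
      · have h2 := gaussMod_le_of_gaussMod_mul_le hB ((t : ℂ) • z)
        have h3 : P ≤ Real.exp (-(1 / 2 * x)) := by
          rw [hP, Real.exp_le_exp]
          nlinarith
        have h5 : (1 + ‖(t : ℂ) • z‖) ^ |γ| ≤ (1 + x) ^ |γ| := by
          rw [htz]
          gcongr
          nlinarith [ht.2]
        have h6 := hD₁ x hx0
        calc gaussMod f ((t : ℂ) • z) * P
            ≤ B * (1 + x) ^ |γ| * Real.exp (-(1 / 2 * x)) := by
              refine mul_le_mul (h2.trans (by gcongr)) h3 hP0.le (by positivity)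
          _ = B * ((1 + x) ^ |γ| * Real.exp (-(1 / 2 * x))) := by ring
          _ ≤ B * (D₁ * (1 + x) ^ (-M)) := by gcongr
          _ = D₁ * Q := by rw [hQ]; ring
          _ ≤ (1 + D₁) * (P * S + Q) := by
              have : 0 ≤ P * S := by positivity
              nlinarith [mul_nonneg hD₁0 this]
    have hK : 1 ≤ t ^ K * 4 ^ K := by
      rw [← mul_pow]
      exact one_le_pow₀ (by linarith)
    have hpos : 0 ≤ (1 + D₁) * (P * S + Q) * E := by positivity
    calc ‖f ((t : ℂ) • z)‖ ≤ gaussMod f ((t : ℂ) • z) * P * E := hgap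
      _ ≤ (1 + D₁) * (P * S + Q) * E := by gcongr
      _ ≤ t ^ K * 4 ^ K * ((1 + D₁) * (P * S + Q) * E) := le_mul_of_one_le_left hpos hK
      _ = t ^ K * (4 ^ K * (1 + D₁) * E * (P * S + Q)) := by ring
      _ ≤ t ^ K * ((4 ^ K * (1 + D₁) + 4 ^ K * 2 * D₂) * E * (P * S + Q)) := by
          gcongr
          have : 0 ≤ (4 : ℝ) ^ K * 2 * D₂ := by positivity
          linarith

/-- Fractional integration of order `c` gains `(1 + |z|)^{-2c}`. -/
theorem exists_gaussMod_multiplier_gammaRatio_le (n K : ℕ) {a c : ℝ} (ha : 0 < a + K) (hc : 0 < c)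
    (γ M : ℝ) :
    ∃ C, 0 ≤ C ∧ ∀ f ∈ Entire n, (∀ k < K, ∀ z, homPart f k z = 0) → ∀ z S B,
      (∀ w, ‖w - z‖ ≤ 1 → gaussMod f w ≤ S) → (∀ w, gaussMod f w * (1 + ‖w‖) ^ γ ≤ B) →
      gaussMod (multiplier (gammaRatio K a (a + c)) f) z * (1 + ‖z‖) ^ (γ + 2 * c) ≤
        C * ((1 + ‖z‖) ^ γ * S + (1 + ‖z‖) ^ (-M) * B) := by
  -- The extra decay pays for the weight `(1+|z|)^{γ+2c}` on the left.
  obtain ⟨D, hD0, hD⟩ := exists_norm_smul_le_radial n K γ (M + (γ + 2 * c))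
  obtain ⟨A, hA0, hA⟩ := exists_integral_beta_mul_exp_le ha hc
  have hG := Real.Gamma_pos_of_pos hc
  set b := ∫ t in Set.Ioc (0 : ℝ) 1, t ^ (a + K - 1) * (1 - t) ^ (c - 1) with hb
  have hker : ∀ t ∈ Set.Ioc (0 : ℝ) 1, 0 ≤ t ^ (a + K - 1) * (1 - t) ^ (c - 1) := fun t ht =>
    mul_nonneg (Real.rpow_nonneg ht.1.le _) (Real.rpow_nonneg (by linarith [ht.2]) _)
  have hb0 : 0 ≤ b := setIntegral_nonneg measurableSet_Ioc hker
  refine ⟨(Real.Gamma c)⁻¹ * D * (A + b), by positivity, fun f hf hlow z S B hS hB => ?_⟩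
  have hB0 := nonneg_of_gaussMod_mul_le hB
  have hS0 : 0 ≤ S := (gaussMod_nonneg f z).trans (hS z (by simp))
  set x := ‖z‖ with hx
  have hx0 : 0 ≤ x := norm_nonneg z
  have hx1 : (0 : ℝ) < 1 + x := by positivity
  set E := Real.exp (x ^ 2 / 2) with hE
  set Q := (1 + x) ^ (-(M + (γ + 2 * c))) * B with hQ
  have hQ0 : 0 ≤ Q := by positivity
  have hint := integrableOn_beta ha hc
  have hint2 : IntegrableOn (fun t : ℝ => t ^ (a + K - 1) * (1 - t) ^ (c - 1) *
      Real.exp (-((1 - t) * x ^ 2 / 2))) (Set.Ioc 0 1) := by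
    refine Integrable.mono' hint (hint.aestronglyMeasurable.mul
      (by fun_prop : Continuous fun t : ℝ =>
        Real.exp (-((1 - t) * x ^ 2 / 2))).aestronglyMeasurable)
      ((ae_restrict_iff' measurableSet_Ioc).mpr (ae_of_all _ fun t ht => ?_))
    rw [norm_mul, Real.norm_of_nonneg (hker t ht), Real.norm_of_nonneg (Real.exp_pos _).le]
    refine mul_le_of_le_one_right (hker t ht) (Real.exp_le_one_iff.mpr ?_)
    have : 0 ≤ 1 - t := by linarith [ht.2]
    have : 0 ≤ (1 - t) * x ^ 2 / 2 := by positivity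
    linarith
  have hsplit : (fun t : ℝ => t ^ (a + K - 1) * (1 - t) ^ (c - 1) *
      (D * E * (Real.exp (-((1 - t) * x ^ 2 / 2)) * S + Q))) = fun t : ℝ =>
      D * E * S * (t ^ (a + K - 1) * (1 - t) ^ (c - 1) * Real.exp (-((1 - t) * x ^ 2 / 2))) +
      D * E * Q * (t ^ (a + K - 1) * (1 - t) ^ (c - 1)) := by
    ext t
    ring
  have h1 := norm_multiplier_gammaRatio_le ha hc hf hlow z
    (φ := fun t => D * E * (Real.exp (-((1 - t) * x ^ 2 / 2)) * S + Q))
    (by rw [hsplit]; exact (hint2.const_mul _).add (hint.const_mul _))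
    (hD f hf hlow z S B hS hB)
  rw [hsplit, integral_add (hint2.const_mul _) (hint.const_mul _), integral_const_mul,
    integral_const_mul, ← hb] at h1
  have h2 : ‖multiplier (gammaRatio K a (a + c)) f z‖ ≤
      (Real.Gamma c)⁻¹ * D * (A + b) * ((1 + x) ^ (-(2 * c)) * S + Q) * E := by
    refine h1.trans ?_
    have h3 : D * E * S * ∫ t in Set.Ioc (0 : ℝ) 1, t ^ (a + K - 1) * (1 - t) ^ (c - 1) *
        Real.exp (-((1 - t) * x ^ 2 / 2)) ≤ D * E * S * (A * (1 + x) ^ (-(2 * c))) := by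
      gcongr
      exact hA x hx0
    have h4 : 0 ≤ D * E * ((1 + x) ^ (-(2 * c)) * S * b + A * Q) := by positivity
    calc _ ≤ (Real.Gamma c)⁻¹ * (D * E * S * (A * (1 + x) ^ (-(2 * c))) + D * E * Q * b) := by
          gcongr
      _ ≤ (Real.Gamma c)⁻¹ * (D * E * S * (A * (1 + x) ^ (-(2 * c))) + D * E * Q * b +
            D * E * ((1 + x) ^ (-(2 * c)) * S * b + A * Q)) :=
          mul_le_mul_of_nonneg_left (le_add_of_nonneg_right h4) (inv_nonneg.mpr hG.le)
      _ = _ := by ring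
  have hEE : E * Real.exp (-x ^ 2 / 2) = 1 := by
    rw [hE, ← Real.exp_add, neg_div, add_neg_cancel, Real.exp_zero]
  have e1 : (1 + x) ^ (-(2 * c)) * (1 + x) ^ (γ + 2 * c) = (1 + x) ^ γ := by
    rw [← Real.rpow_add hx1]
    ring_nf
  have e2 : Q * (1 + x) ^ (γ + 2 * c) = (1 + x) ^ (-M) * B := by
    rw [hQ, mul_right_comm, ← Real.rpow_add hx1]
    ring_nf
  rw [gaussMod, ← hx]
  calc ‖multiplier (gammaRatio K a (a + c)) f z‖ * Real.exp (-x ^ 2 / 2) * (1 + x) ^ (γ + 2 * c)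
      ≤ (Real.Gamma c)⁻¹ * D * (A + b) * ((1 + x) ^ (-(2 * c)) * S + Q) * E *
        Real.exp (-x ^ 2 / 2) * (1 + x) ^ (γ + 2 * c) := by gcongr
    _ = (Real.Gamma c)⁻¹ * D * (A + b) * ((1 + x) ^ (-(2 * c)) * (1 + x) ^ (γ + 2 * c) * S +
        Q * (1 + x) ^ (γ + 2 * c)) * (E * Real.exp (-x ^ 2 / 2)) := by ring
    _ = _ := by rw [e1, e2, hEE, mul_one]

/-! ### Taylor polynomials and boundedness of Gamma-quotient multipliers -/

theorem gaussMod_sub_le {n : ℕ} (f g : Cn n → ℂ) (z : Cn n) :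
    gaussMod (fun w => f w - g w) z ≤ gaussMod f z + gaussMod g z := by
  unfold gaussMod
  rw [← add_mul]
  gcongr
  exact norm_sub_le _ _

theorem gaussMod_sum_le {n : ℕ} {ι : Type*} (s : Finset ι) (f : ι → Cn n → ℂ) (z : Cn n) :
    gaussMod (fun w => ∑ i ∈ s, f i w) z ≤ ∑ i ∈ s, gaussMod (f i) z := by
  unfold gaussMod
  rw [← Finset.sum_mul]
  gcongr
  exact norm_sum_le _ _

/-- The Taylor polynomial of degree less than `K`. -/
noncomputable def taylorSum {n : ℕ} (K : ℕ) (f : Cn n → ℂ) (z : Cn n) : ℂ :=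
  ∑ k ∈ Finset.range K, homPart f k z

theorem exists_gaussMod_taylorSum_le (n K : ℕ) (γ γ' M : ℝ) :
    ∃ C, 0 ≤ C ∧ ∀ f ∈ Entire n, ∀ B, (∀ w, gaussMod f w * (1 + ‖w‖) ^ γ ≤ B) →
      ∀ z, gaussMod (taylorSum K f) z * (1 + ‖z‖) ^ γ' ≤ C * ((1 + ‖z‖) ^ (-M) * B) := by
  choose C hC0 hC using fun k => exists_gaussMod_homPart_le n k γ γ' M
  refine ⟨∑ k ∈ Finset.range K, C k, Finset.sum_nonneg fun k _ => hC0 k, fun f hf B hB z => ?_⟩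
  refine (mul_le_mul_of_nonneg_right (gaussMod_sum_le _ _ z) (by positivity)).trans ?_
  rw [Finset.sum_mul, Finset.sum_mul]
  exact Finset.sum_le_sum fun k _ => hC k f hf B hB z

theorem entire_taylorSum {n : ℕ} {f : Cn n → ℂ} (hf : f ∈ Entire n) (K : ℕ) :
    taylorSum K f ∈ Entire n := by
  have : Differentiable ℂ fun z => ∑ k ∈ Finset.range K, homPart f k z :=
    Differentiable.fun_sum fun k _ => entire_homPart hf k
  exact this

/-- Polynomial parts are controlled in any weight. -/
theorem exists_fockNorm_taylorSum_le (n K : ℕ) {p : ℝ≥0∞} (hp : p ≠ 0) (γ γ' : ℝ) :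
    ∃ C : ℝ≥0, ∀ f ∈ Entire n, fockNorm p γ' (taylorSum K f) ≤ C * fockNorm p γ f := by
  obtain ⟨M, hM⟩ := exists_fockNorm_le_of_local_bound n hp γ
  obtain ⟨D, hD0, hD⟩ := exists_gaussMod_taylorSum_le n K γ γ' M
  obtain ⟨C, hC⟩ := hM γ' D hD0
  refine ⟨C, fun f hf => hC f hf _ fun z S B hS hB => (hD f hf B hB z).trans ?_⟩
  have hS0 : 0 ≤ S := (gaussMod_nonneg f z).trans (hS z (by simp))
  gcongr
  have : 0 ≤ (1 + ‖z‖) ^ γ * S := by positivity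
  linarith

theorem exists_fockNorm_sub_taylorSum_le (n K : ℕ) {p : ℝ≥0∞} (hp : p ≠ 0) (γ : ℝ) :
    ∃ C : ℝ≥0, ∀ f ∈ Entire n,
      fockNorm p γ (fun z => f z - taylorSum K f z) ≤ C * fockNorm p γ f := by
  obtain ⟨M, hM⟩ := exists_fockNorm_le_of_local_bound n hp γ
  obtain ⟨D, hD0, hD⟩ := exists_gaussMod_taylorSum_le n K γ γ M
  obtain ⟨C, hC⟩ := hM γ (1 + D) (by positivity)
  refine ⟨C, fun f hf => hC f hf _ fun z S B hS hB => ?_⟩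
  have h1 := hD f hf B hB z
  have hB0 := nonneg_of_gaussMod_mul_le hB
  have hSz : gaussMod f z ≤ S := hS z (by simp)
  have hS0 : 0 ≤ S := (gaussMod_nonneg f z).trans hSz
  have hw : 0 ≤ (1 + ‖z‖) ^ γ := by positivity
  have h2 := mul_le_mul_of_nonneg_right (gaussMod_sub_le f (taylorSum K f) z) hw
  have h3 := mul_le_mul_of_nonneg_right hSz hw
  have h4 : 0 ≤ (1 + ‖z‖) ^ (-M) * B := by positivity
  have h5 : 0 ≤ D * ((1 + ‖z‖) ^ γ * S) := by positivity
  linarith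

theorem slowGrowth_indicator (K : ℕ) : SlowGrowth fun k => if K ≤ k then 1 else 0 := by
  refine Summable.of_nonneg_of_le (fun k => by positivity) (fun k => ?_) summable_geometric_two
  refine mul_le_of_le_one_left (by positivity) ?_
  dsimp only
  split_ifs <;> simp

theorem slowGrowth_truncation (K : ℕ) : SlowGrowth fun k => if k < K then 1 else 0 := by
  refine Summable.of_nonneg_of_le (fun k => by positivity) (fun k => ?_) summable_geometric_two
  refine mul_le_of_le_one_left (by positivity) ?_
  dsimp only
  split_ifs <;> simp

theorem taylorSum_eq_multiplier {n : ℕ} (f : Cn n → ℂ) (K : ℕ) :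
    taylorSum K f = multiplier (fun k => if k < K then 1 else 0) f := by
  ext z
  rw [multiplier, tsum_eq_sum (s := Finset.range K) fun k hk => by
    rw [if_neg (by simpa using hk)]
    simp]
  refine Finset.sum_congr rfl fun k hk => ?_
  rw [if_pos (Finset.mem_range.mp hk)]
  simp

theorem taylorSum_taylorSum {n : ℕ} {f : Cn n → ℂ} (hf : f ∈ Entire n) (K : ℕ) :
    taylorSum K (taylorSum K f) = taylorSum K f := by
  ext z
  rw [taylorSum_eq_multiplier, taylorSum_eq_multiplier,
    multiplier_multiplier (slowGrowth_truncation K) hf]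
  congr 1
  ext k
  split_ifs <;> simp

theorem sub_taylorSum_eq_multiplier {n : ℕ} {f : Cn n → ℂ} (hf : f ∈ Entire n) (K : ℕ) (z : Cn n) :
    f z - taylorSum K f z = multiplier (fun k => if K ≤ k then 1 else 0) f z := by
  have h1 := hasSum_multiplier (slowGrowth_indicator K) hf z
  have h2 := hasSum_multiplier (slowGrowth_truncation K) hf z
  rw [← taylorSum_eq_multiplier] at h2
  refine ((hasSum_homPart hf z).sub h2).unique ?_
  have e : (fun k => homPart f k z - ((if k < K then 1 else 0 : ℝ) : ℂ) * homPart f k z) =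
      fun k => ((if K ≤ k then 1 else 0 : ℝ) : ℂ) * homPart f k z := by
    ext k
    by_cases hk : K ≤ k
    · simp [hk, not_lt.mpr hk]
    · simp [hk, not_le.mp hk]
  rw [e]
  exact h1

/-- The multiplier does not see degrees below `K`, so `f` may be replaced by `f` minus its Taylor
polynomial, which vanishes to order `K` and whose norm is still controlled. -/
theorem exists_fockNorm_multiplier_gammaRatio_le_of_lt (n K : ℕ) {p : ℝ≥0∞} (hp : p ≠ 0)
    {a c : ℝ} (ha : 0 < a + K) (hc : 0 < c) (γ : ℝ) :
    ∃ C : ℝ≥0, ∀ f ∈ Entire n,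
      fockNorm p (γ + 2 * c) (multiplier (gammaRatio K a (a + c)) f) ≤ C * fockNorm p γ f := by
  obtain ⟨C₁, hC₁⟩ := exists_fockNorm_sub_taylorSum_le n K hp γ
  obtain ⟨M, hM⟩ := exists_fockNorm_le_of_local_bound n hp γ
  obtain ⟨D, hD0, hD⟩ := exists_gaussMod_multiplier_gammaRatio_le n K ha hc γ M
  obtain ⟨C₂, hC₂⟩ := hM (γ + 2 * c) D hD0
  refine ⟨C₂ * C₁, fun f hf => ?_⟩
  set g : Cn n → ℂ := fun z => f z - taylorSum K f z with hg
  have hge : g = multiplier (fun k => if K ≤ k then 1 else 0) f := by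
    ext z
    exact sub_taylorSum_eq_multiplier hf K z
  have hgE : g ∈ Entire n := by
    rw [hge]
    exact entire_multiplier (slowGrowth_indicator K) hf
  have hlow : ∀ k < K, ∀ z, homPart g k z = 0 := fun k hk z => by
    rw [hge, homPart_multiplier (slowGrowth_indicator K) hf, if_neg (not_le.mpr hk)]
    simp
  have hT : multiplier (gammaRatio K a (a + c)) f = multiplier (gammaRatio K a (a + c)) g := by
    ext z
    rw [hge, multiplier_multiplier (slowGrowth_indicator K) hf]
    congr 1
    ext k
    by_cases hk : K ≤ k <;> simp [gammaRatio, hk]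
  rw [hT, ENNReal.coe_mul, mul_assoc]
  refine (hC₂ g hgE _ (hD g hgE hlow)).trans ?_
  gcongr
  exact hC₁ f hf

theorem exists_fockNorm_multiplier_natCast_add_le (n : ℕ) {p : ℝ≥0∞} (hp : p ≠ 0) (b γ : ℝ) :
    ∃ C : ℝ≥0, ∀ f ∈ Entire n,
      fockNorm p (γ - 2) (multiplier (fun k => k + b) f) ≤ C * fockNorm p γ f := by
  obtain ⟨M, hM⟩ := exists_fockNorm_le_of_local_bound n hp γ
  obtain ⟨C, hC⟩ := hM (γ - 2) (1 + |b| + Real.exp (1 / 2)) (by positivity)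
  refine ⟨C, fun f hf => hC f hf _ fun z S B hS hB => ?_⟩
  have h1 := gaussMod_multiplier_natCast_add_le hf b hS
  have hB0 := nonneg_of_gaussMod_mul_le hB
  have hx1 : (0 : ℝ) < 1 + ‖z‖ := by positivity
  have e : (1 + ‖z‖) ^ 2 * (1 + ‖z‖) ^ (γ - 2) = (1 + ‖z‖) ^ γ := by
    rw [← Real.rpow_natCast, ← Real.rpow_add hx1]
    norm_num
  calc _ ≤ (1 + |b| + Real.exp (1 / 2)) * ((1 + ‖z‖) ^ 2 * S) * (1 + ‖z‖) ^ (γ - 2) := by gcongr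
    _ = (1 + |b| + Real.exp (1 / 2)) * ((1 + ‖z‖) ^ 2 * (1 + ‖z‖) ^ (γ - 2) * S) := by ring
    _ = (1 + |b| + Real.exp (1 / 2)) * ((1 + ‖z‖) ^ γ * S + 0) := by rw [e, add_zero]
    _ ≤ _ := by gcongr; positivity

/-- The multiplier `Γ(a + k) / Γ(b + k)` of order `a - b` maps the Fock space with weight
exponent `γ` boundedly to the one with weight exponent `γ - 2 (a - b)`. -/
theorem exists_fockNorm_multiplier_gammaRatio_le (n K : ℕ) {p : ℝ≥0∞} (hp : p ≠ 0) {a b : ℝ}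
    (ha : 0 < a + K) (hb : 0 < b + K) (γ : ℝ) :
    ∃ C : ℝ≥0, ∀ f ∈ Entire n,
      fockNorm p (γ - 2 * (a - b)) (multiplier (gammaRatio K a b) f) ≤ C * fockNorm p γ f := by
  -- Induction on a strict upper bound for the order: at `N = 0` the order is negative and
  -- fractional integration applies; otherwise `Γ(b+1+k) = (b+k) Γ(b+k)` splits off one factor `k +
  -- b`.
  obtain ⟨N, hN⟩ := exists_nat_gt (a - b)
  induction N generalizing b with
  | zero =>
    have hc : 0 < b - a := by simp at hN; linarith
    have := exists_fockNorm_multiplier_gammaRatio_le_of_lt n K hp ha hc γ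
    rwa [show γ + 2 * (b - a) = γ - 2 * (a - b) by ring, add_sub_cancel] at this
  | succ N ih =>
    obtain ⟨C₁, hC₁⟩ := ih (b := b + 1) (by linarith) (by push_cast at hN; linarith)
    obtain ⟨C₂, hC₂⟩ := exists_fockNorm_multiplier_natCast_add_le n hp b (γ - 2 * (a - (b + 1)))
    refine ⟨C₂ * C₁, fun f hf => ?_⟩
    have hsg : SlowGrowth (gammaRatio K a (b + 1)) := slowGrowth_gammaRatio ha (by linarith)
    have hT : multiplier (gammaRatio K a b) f =
        multiplier (fun k => k + b) (multiplier (gammaRatio K a (b + 1)) f) := by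
      ext z
      rw [multiplier_multiplier hsg hf]
      congr 1
      ext k
      by_cases hk : K ≤ k
      · have hbk : 0 < b + k := by
          have : (K : ℝ) ≤ k := Nat.cast_le.mpr hk
          linarith
        have hG := Real.Gamma_pos_of_pos hbk
        simp only [gammaRatio, if_pos hk]
        rw [show b + 1 + k = b + k + 1 by ring, Real.Gamma_add_one hbk.ne']
        field_simp
        ring
      · simp [gammaRatio, hk]
    have h2 := hC₂ _ (entire_multiplier hsg hf)
    rw [show γ - 2 * (a - (b + 1)) - 2 = γ - 2 * (a - b) by ring, ← hT] at h2
    rw [ENNReal.coe_mul, mul_assoc]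
    refine h2.trans ?_
    gcongr
    exact hC₁ f hf

/-! ### Translation between the `L^p_α` norms and weight exponents -/

/-- The exponent of `1 + |z|` in the norm of `L^p_α`. -/
noncomputable def weightExp (p : ℝ≥0∞) (α : ℝ) : ℝ := if p = ∞ then -α else -α / p.toReal

theorem LNorm_eq_eLpNorm {n : ℕ} {p : ℝ≥0∞} (hp : p ≠ 0) (α : ℝ) (ψ : Cn n → ℂ) :
    LNorm p α ψ = eLpNorm (fun z => gaussMod ψ z * (1 + ‖z‖) ^ weightExp p α) p (dV n) := by
  by_cases hpt : p = ∞
  · rw [LNorm, weightExp, if_pos hpt, if_pos hpt, hpt, eLpNorm_exponent_top, eLpNormEssSup]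
    congr 1
    ext z
    have hz : (0 : ℝ) < 1 + ‖z‖ := by positivity
    have hg := gaussMod_nonneg ψ z
    rw [Real.enorm_of_nonneg (by positivity), Real.rpow_neg hz.le, ← div_eq_mul_inv, gaussMod]
  · have hq : 0 < p.toReal := ENNReal.toReal_pos hp hpt
    rw [LNorm, weightExp, if_neg hpt, if_neg hpt, eLpNorm_eq_lintegral_rpow_enorm_toReal hp hpt,
      dVw]
    congr 1
    have hm : Measurable fun z : Cn n => ENNReal.ofReal ((1 + ‖z‖) ^ (-α)) :=
      (continuous_one_add_norm_rpow (-α)).measurable.ennreal_ofReal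
    rw [lintegral_withDensity_eq_lintegral_mul_non_measurable _ hm
      (ae_of_all _ fun z => ENNReal.ofReal_lt_top)]
    refine lintegral_congr fun z => ?_
    have hz : (0 : ℝ) < 1 + ‖z‖ := by positivity
    have hg := gaussMod_nonneg ψ z
    rw [Real.enorm_of_nonneg (by positivity), ENNReal.ofReal_mul hg,
      ENNReal.mul_rpow_of_nonneg _ _ hq.le,
      ENNReal.ofReal_rpow_of_nonneg (x := (1 + ‖z‖) ^ (-α / p.toReal)) (by positivity) hq.le,
      ← Real.rpow_mul hz.le, div_mul_cancel₀ _ hq.ne', mul_comm, Pi.mul_apply, gaussMod, mul_comm]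

theorem LNorm_eq_fockNorm {n : ℕ} {p : ℝ≥0∞} (hp : p ≠ 0) (α : ℝ) (f : Cn n → ℂ) :
    LNorm p α f = fockNorm p (weightExp p α) f :=
  LNorm_eq_eLpNorm hp α f

theorem LNorm_inv_rpow_mul {n : ℕ} {p : ℝ≥0∞} (hp : p ≠ 0) (α s : ℝ) (g : Cn n → ℂ) :
    LNorm p α (fun z => (((1 + ‖z‖) ^ s : ℝ) : ℂ)⁻¹ * g z) =
      fockNorm p (weightExp p α - s) g := by
  rw [LNorm_eq_eLpNorm hp, fockNorm]
  congr 1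
  ext z
  have hz : (0 : ℝ) < 1 + ‖z‖ := by positivity
  rw [gaussMod, gaussMod, norm_mul, norm_inv, Complex.norm_real,
    Real.norm_of_nonneg (by positivity), Real.rpow_sub hz]
  field_simp

theorem fockNorm_lt_top_of_le {n : ℕ} {p : ℝ≥0∞} (hp : p ≠ 0) {γ : ℝ} {g : Cn n → ℂ}
    (h : ∀ M : ℝ, ∃ C, 0 ≤ C ∧ ∀ z, gaussMod g z * (1 + ‖z‖) ^ γ ≤ C * (1 + ‖z‖) ^ (-M)) :
    fockNorm p γ g < ∞ := by
  have hnn : ∀ z, 0 ≤ gaussMod g z * (1 + ‖z‖) ^ γ := fun z =>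
    mul_nonneg (gaussMod_nonneg g z) (by positivity)
  by_cases hpt : p = ∞
  · obtain ⟨C, hC0, hC⟩ := h 0
    rw [fockNorm, hpt, eLpNorm_exponent_top]
    refine (eLpNormEssSup_le_of_ae_bound (C := C) (ae_of_all _ fun z => ?_)).trans_lt
      ENNReal.ofReal_lt_top
    rw [Real.norm_of_nonneg (hnn z)]
    simpa using hC z
  · have hq : 0 < p.toReal := ENNReal.toReal_pos hp hpt
    set r : ℝ := Module.finrank ℝ (Cn n) + 1 with hr
    obtain ⟨C, hC0, hC⟩ := h (r / p.toReal)
    rw [fockNorm, eLpNorm_lt_top_iff_lintegral_rpow_enorm_lt_top hp hpt]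
    have hI := lintegral_one_add_norm_rpow_lt_top n (r := r) (by simp [hr])
    have hle : ∀ z : Cn n, ‖gaussMod g z * (1 + ‖z‖) ^ γ‖ₑ ^ p.toReal ≤
        ENNReal.ofReal C ^ p.toReal * ENNReal.ofReal ((1 + ‖z‖) ^ (-r)) := fun z => by
      have hz : (0 : ℝ) ≤ 1 + ‖z‖ := by positivity
      have e : (1 + ‖z‖) ^ (-r) = ((1 + ‖z‖) ^ (-(r / p.toReal))) ^ p.toReal := by
        rw [← Real.rpow_mul hz, neg_mul, div_mul_cancel₀ _ hq.ne']
      rw [e, ← ENNReal.ofReal_rpow_of_nonneg (by positivity) hq.le,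
        ← ENNReal.mul_rpow_of_nonneg _ _ hq.le, ← ENNReal.ofReal_mul hC0,
        Real.enorm_of_nonneg (hnn z)]
      exact ENNReal.rpow_le_rpow (ENNReal.ofReal_le_ofReal (hC z)) hq.le
    refine (lintegral_mono hle).trans_lt ?_
    rw [lintegral_const_mul' _ _ (by simp [hq.le])]
    exact ENNReal.mul_lt_top (by simp [hq.le, lt_top_iff_ne_top]) hI

/-- The Fock–Sobolev spaces only require the fractional derivative or integral to lie in `L^p_α`,
while the norms may also contain the low part; its finiteness for every entire `f` reconciles the
two. -/
theorem fockNorm_taylorSum_lt_top {n : ℕ} (K : ℕ) {p : ℝ≥0∞} (hp : p ≠ 0) (γ : ℝ)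
    {f : Cn n → ℂ} (hf : f ∈ Entire n) : fockNorm p γ (taylorSum K f) < ∞ := by
  refine fockNorm_lt_top_of_le hp fun M => ?_
  have hf' : Differentiable ℂ f := hf
  obtain ⟨S, hS0, hS⟩ := exists_norm_le_of_norm_le hf'.continuous 1
  choose D hD0 hD using fun k : ℕ =>
    exists_rpow_mul_exp_neg_sq_le (k + γ) M (a := 1 / 2) (by norm_num)
  refine ⟨∑ k ∈ Finset.range K, S * D k,
    Finset.sum_nonneg fun k _ => mul_nonneg hS0 (hD0 k), fun z => ?_⟩
  have hz : (0 : ℝ) < 1 + ‖z‖ := by positivity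
  refine (mul_le_mul_of_nonneg_right (gaussMod_sum_le _ _ z) (by positivity)).trans ?_
  rw [Finset.sum_mul, Finset.sum_mul]
  refine Finset.sum_le_sum fun k _ => ?_
  have h1 := norm_homPart_le_of_norm_le hf hS k z
  have h2 := hD k ‖z‖ (norm_nonneg z)
  rw [Real.rpow_add hz, Real.rpow_natCast] at h2
  rw [gaussMod, show -‖z‖ ^ 2 / 2 = -(1 / 2 * ‖z‖ ^ 2) by ring]
  calc ‖homPart f k z‖ * Real.exp (-(1 / 2 * ‖z‖ ^ 2)) * (1 + ‖z‖) ^ γ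
      ≤ (S * (1 + ‖z‖) ^ k) * Real.exp (-(1 / 2 * ‖z‖ ^ 2)) * (1 + ‖z‖) ^ γ := by gcongr
    _ = S * ((1 + ‖z‖) ^ k * (1 + ‖z‖) ^ γ * Real.exp (-(1 / 2 * ‖z‖ ^ 2))) := by ring
    _ ≤ S * (D k * (1 + ‖z‖) ^ (-M)) := mul_le_mul_of_nonneg_left h2 hS0
    _ = _ := by ring

/-! ### Inversion and equivalence of norms -/

theorem multiplier_gammaRatio_inverse {n K : ℕ} {a b : ℝ} (ha : 0 < a + K) (hb : 0 < b + K)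
    {f : Cn n → ℂ} (hf : f ∈ Entire n) (z : Cn n) :
    multiplier (gammaRatio K b a) (multiplier (gammaRatio K a b) f) z = f z - taylorSum K f z := by
  rw [multiplier_multiplier (slowGrowth_gammaRatio ha hb) hf, sub_taylorSum_eq_multiplier hf]
  congr 1
  ext k
  by_cases hk : K ≤ k
  · have hkK : (K : ℝ) ≤ k := Nat.cast_le.mpr hk
    have h1 := Real.Gamma_pos_of_pos (show 0 < a + k by linarith)
    have h2 := Real.Gamma_pos_of_pos (show 0 < b + k by linarith)
    simp only [gammaRatio, if_pos hk]
    field_simp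
  · simp [gammaRatio, hk]

/-- `ENNReal.LpAddConst` is the quasi-triangle constant needed for `p < 1`. -/
theorem fockNorm_le_add {n : ℕ} {p : ℝ≥0∞} (γ : ℝ) {f g : Cn n → ℂ} (hf : Continuous f)
    (hg : Continuous g) : fockNorm p γ f ≤
      ENNReal.LpAddConst p * (fockNorm p γ g + fockNorm p γ (fun z => f z - g z)) := by
  unfold fockNorm
  have hc : ∀ {h : Cn n → ℂ}, Continuous h →
      AEStronglyMeasurable (fun z => gaussMod h z * (1 + ‖z‖) ^ γ) (dV n) := fun hh =>
    ((continuous_gaussMod hh).mul (continuous_one_add_norm_rpow γ)).aestronglyMeasurable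
  refine le_trans (eLpNorm_mono_real fun z => ?_) (eLpNorm_add_le' (hc hg) (hc (hf.sub hg)) p)
  have h0 : 0 ≤ (1 + ‖z‖) ^ γ := by positivity
  have hgf := gaussMod_nonneg f z
  rw [Real.norm_of_nonneg (by positivity), Pi.add_apply, ← add_mul]
  refine mul_le_mul_of_nonneg_right ?_ h0
  unfold gaussMod
  rw [← add_mul]
  refine mul_le_mul_of_nonneg_right ?_ (Real.exp_pos _).le
  have := norm_add_le (g z) (f z - g z)
  rwa [add_sub_cancel] at this

/-- The inverse Gamma quotient is a multiplier of the same kind and returns `f` minus its Taylor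
polynomial; idempotence of truncation lets the polynomial be measured in any weight `γ'`. -/
theorem exists_fockNorm_le_multiplier_add_taylorSum (n K : ℕ) {p : ℝ≥0∞} (hp : p ≠ 0) {a b : ℝ}
    (ha : 0 < a + K) (hb : 0 < b + K) (γ γ' : ℝ) :
    ∃ C : ℝ≥0, ∀ f ∈ Entire n, fockNorm p γ f ≤ C *
      (fockNorm p (γ - 2 * (a - b)) (multiplier (gammaRatio K a b) f) +
        fockNorm p γ' (taylorSum K f)) := by
  obtain ⟨C₁, hC₁⟩ := exists_fockNorm_taylorSum_le n K hp γ' γ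
  obtain ⟨C₂, hC₂⟩ := exists_fockNorm_multiplier_gammaRatio_le n K hp hb ha (γ - 2 * (a - b))
  have hL : ENNReal.LpAddConst p ≠ ∞ := (ENNReal.LpAddConst_lt_top p).ne
  refine ⟨(ENNReal.LpAddConst p).toNNReal * (C₁ + C₂), fun f hf => ?_⟩
  have hf' : Differentiable ℂ f := hf
  have hLf := entire_taylorSum hf K
  have hLc : Differentiable ℂ (taylorSum K f) := hLf
  have h1 := hC₁ _ hLf
  rw [taylorSum_taylorSum hf] at h1
  have h2 := hC₂ _ (entire_multiplier (slowGrowth_gammaRatio ha hb) hf)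
  have e : multiplier (gammaRatio K b a) (multiplier (gammaRatio K a b) f) =
      fun z => f z - taylorSum K f z := funext fun z => multiplier_gammaRatio_inverse ha hb hf z
  rw [show γ - 2 * (a - b) - 2 * (b - a) = γ by ring, e] at h2
  refine (fockNorm_le_add γ hf'.continuous hLc.continuous).trans ?_
  rw [ENNReal.coe_mul, ENNReal.coe_toNNReal hL, mul_assoc]
  gcongr
  push_cast
  refine (add_le_add h1 h2).trans ?_
  rw [add_mul, mul_add, mul_add, add_comm (_ * _) (_ * fockNorm p γ' _)]
  exact add_le_add le_self_add le_self_add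

theorem EquivNorms.symm {n : ℕ} {N N' : (Cn n → ℂ) → ℝ≥0∞} (h : EquivNorms N N') :
    EquivNorms N' N := by
  obtain ⟨C, hC, H⟩ := h
  exact ⟨C, hC, fun f hf => (H f hf).symm⟩

theorem EquivNorms.trans {n : ℕ} {N N' N'' : (Cn n → ℂ) → ℝ≥0∞} (h : EquivNorms N N')
    (h' : EquivNorms N' N'') : EquivNorms N N'' := by
  obtain ⟨C, hC, H⟩ := h
  obtain ⟨D, hD, H'⟩ := h'
  refine ⟨C * D, mul_pos hC hD, fun f hf => ⟨?_, ?_⟩⟩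
  · rw [ENNReal.coe_mul, mul_assoc]
    refine (H f hf).1.trans ?_
    gcongr
    exact (H' f hf).1
  · rw [mul_comm C D, ENNReal.coe_mul, mul_assoc]
    refine (H' f hf).2.trans ?_
    gcongr
    exact (H f hf).2

theorem EquivNorms.lt_top_iff {n : ℕ} {N N' : (Cn n → ℂ) → ℝ≥0∞} (h : EquivNorms N N')
    {f : Cn n → ℂ} (hf : f ∈ Entire n) : N f < ∞ ↔ N' f < ∞ := by
  obtain ⟨C, -, H⟩ := h
  exact ⟨fun h1 => (H f hf).2.trans_lt (ENNReal.mul_lt_top ENNReal.coe_lt_top h1),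
    fun h1 => (H f hf).1.trans_lt (ENNReal.mul_lt_top ENNReal.coe_lt_top h1)⟩

/-- Every operator `f ↦ (1 + |z|)^{-s} ∑_{k ≥ K} Γ(a + k) / Γ(b + k) f_k` with `a - b = s`
characterizes the Fock space whose weight exponent is shifted by `s`. -/
theorem fockSobolev_of_gammaRatio {n K : ℕ} {p : ℝ≥0∞} (hp : p ≠ 0) {α α' a b : ℝ}
    (hα : weightExp p α' = weightExp p α + (a - b)) (ha : 0 < a + K) (hb : 0 < b + K)
    {op : (Cn n → ℂ) → Cn n → ℂ}
    (hop : ∀ f z, op f z = (((1 + ‖z‖) ^ (a - b) : ℝ) : ℂ)⁻¹ *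
      multiplier (gammaRatio K a b) f z) :
    {f | f ∈ Entire n ∧ op f ∈ LSpace n p α} = FockSpace n p α' ∧
      EquivNorms (fun f => LNorm p α (op f) + LNorm p α (taylorSum K f)) (LNorm p α') := by
  set γ := weightExp p α with hγ
  have hopN : ∀ f, LNorm p α (op f) =
      fockNorm p (γ - (a - b)) (multiplier (gammaRatio K a b) f) := fun f => by
    rw [hγ, ← LNorm_inv_rpow_mul hp]
    congr 1
    exact funext fun z => hop f z
  have hE : EquivNorms (fun f => LNorm p α (op f) + LNorm p α (taylorSum K f))
      (LNorm (n := n) p α') := by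
    obtain ⟨C₁, hC₁⟩ := exists_fockNorm_multiplier_gammaRatio_le n K hp ha hb (γ + (a - b))
    obtain ⟨C₂, hC₂⟩ := exists_fockNorm_taylorSum_le n K hp (γ + (a - b)) γ
    obtain ⟨C₃, hC₃⟩ :=
      exists_fockNorm_le_multiplier_add_taylorSum n K hp ha hb (γ + (a - b)) γ
    -- The shift by `a - b` in the target space is exactly what balances the loss `2 (a - b)` of the
    -- multiplier against the factor `(1+|z|)^{-(a-b)}`.
    rw [show γ + (a - b) - 2 * (a - b) = γ - (a - b) by ring] at hC₁ hC₃
    refine ⟨C₁ + C₂ + C₃ + 1, by positivity, fun f hf => ?_⟩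
    dsimp only
    rw [hopN, LNorm_eq_fockNorm hp, LNorm_eq_fockNorm hp, hα, ← hγ]
    refine ⟨(add_le_add (hC₁ f hf) (hC₂ f hf)).trans ?_, (hC₃ f hf).trans ?_⟩
    · rw [← add_mul]
      gcongr
      push_cast
      rw [add_assoc _ (C₃ : ℝ≥0∞)]
      exact le_self_add
    · gcongr
      rw [add_right_comm]
      exact le_add_self
  refine ⟨Set.ext fun f => ⟨fun ⟨hf, _, hfin⟩ => ?_, fun ⟨⟨_, hfin⟩, hf⟩ => ?_⟩, hE⟩
  · have hf' : Differentiable ℂ f := hf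
    refine ⟨⟨hf'.continuous.aestronglyMeasurable, (hE.lt_top_iff hf).mp ?_⟩, hf⟩
    refine ENNReal.add_lt_top.mpr ⟨hfin, ?_⟩
    rw [LNorm_eq_fockNorm hp]
    exact fockNorm_taylorSum_lt_top K hp _ hf
  · have hT : Differentiable ℂ (multiplier (gammaRatio K a b) f) :=
      entire_multiplier (slowGrowth_gammaRatio ha hb) hf
    refine ⟨hf, ?_, (ENNReal.add_lt_top.mp ((hE.lt_top_iff hf).mpr hfin)).1⟩
    have hopf : op f = fun z => (((1 + ‖z‖) ^ (a - b) : ℝ) : ℂ)⁻¹ *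
        multiplier (gammaRatio K a b) f z := funext (hop f)
    rw [hopf]
    refine Continuous.aestronglyMeasurable (Continuous.mul (Continuous.inv₀ ?_ fun z => ?_)
      hT.continuous)
    · exact Complex.continuous_ofReal.comp (continuous_one_add_norm_rpow _)
    · have : (0 : ℝ) < (1 + ‖z‖) ^ (a - b) := by positivity
      exact_mod_cast this.ne'

/-! ### Specialization to `𝓓^s` and `𝓘^{-s}` -/

/-- The first index `k` in the sums that define `𝓓^s` and `𝓘^s`. -/
noncomputable def firstIndex (s : ℝ) : ℕ := if 0 ≤ s then 0 else ⌊|s|⌋₊ + 1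

theorem firstIndex_le_iff (s : ℝ) (k : ℕ) : firstIndex s ≤ k ↔ 0 ≤ s ∨ |s| < (k : ℝ) := by
  by_cases hs : 0 ≤ s
  · simp [firstIndex, hs]
  · simp [firstIndex, hs, Nat.floor_lt]

theorem add_firstIndex_pos {n : ℕ} (hn : 0 < n) (s : ℝ) : 0 < (n : ℝ) + s + firstIndex s := by
  have hn' : (0 : ℝ) < n := Nat.cast_pos.mpr hn
  rcases (firstIndex_le_iff s (firstIndex s)).mp le_rfl with h | h
  · positivity
  · have := neg_abs_le s
    linarith

theorem fracDeriv_eq_multiplier {n : ℕ} (s : ℝ) (f : Cn n → ℂ) :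
    fracDeriv s f = multiplier (gammaRatio (firstIndex s) (n + s) n) f := by
  ext z
  refine tsum_congr fun k => ?_
  rw [gammaRatio]
  by_cases hk : firstIndex s ≤ k
  · rw [if_pos hk, if_pos ((firstIndex_le_iff s k).mp hk)]
  · rw [if_neg hk, if_neg (mt (firstIndex_le_iff s k).mpr hk)]
    simp

theorem fracInt_eq_multiplier {n : ℕ} (s : ℝ) (f : Cn n → ℂ) :
    fracInt s f = multiplier (gammaRatio (firstIndex s) n (n + s)) f := by
  ext z
  refine tsum_congr fun k => ?_
  rw [gammaRatio]
  by_cases hk : firstIndex s ≤ k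
  · rw [if_pos hk, if_pos ((firstIndex_le_iff s k).mp hk)]
  · rw [if_neg hk, if_neg (mt (firstIndex_le_iff s k).mpr hk)]
    simp

theorem LNorm_taylorSum_zero {n : ℕ} {p : ℝ≥0∞} (hp : p ≠ 0) (α : ℝ) (f : Cn n → ℂ) :
    LNorm p α (taylorSum 0 f) = 0 := by
  rw [LNorm_eq_eLpNorm hp]
  have : (fun z : Cn n => gaussMod (taylorSum 0 f) z * (1 + ‖z‖) ^ weightExp p α) = 0 := by
    ext z
    simp [gaussMod, taylorSum]
  rw [this, eLpNorm_zero]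

/-- Removes the case distinction on the sign of `s`: when the sum starts at `0` the Taylor part is
an empty sum and contributes nothing. -/
theorem FSNorm_eq {n : ℕ} {p : ℝ≥0∞} (hp : p ≠ 0) (α s : ℝ) :
    FSNorm (n := n) p α s =
      fun f => LNorm p α (radDeriv s f) + LNorm p α (taylorSum (firstIndex s) f) := by
  ext f
  by_cases hs : 0 ≤ s
  · rw [FSNorm, if_pos hs, firstIndex, if_pos hs, LNorm_taylorSum_zero hp, add_zero]
  · rw [FSNorm, if_neg hs, firstIndex, if_neg hs]
    rfl

theorem FSTildeNorm_eq {n : ℕ} {p : ℝ≥0∞} (hp : p ≠ 0) (α s : ℝ) :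
    FSTildeNorm (n := n) p α s =
      fun f => LNorm p α (radInt s f) + LNorm p α (taylorSum (firstIndex (-s)) f) := by
  ext f
  by_cases hs : s ≤ 0
  · rw [FSTildeNorm, if_pos hs, firstIndex, if_pos (neg_nonneg.mpr hs), LNorm_taylorSum_zero hp,
      add_zero]
  · rw [FSTildeNorm, if_neg hs, firstIndex, if_neg (by simpa using hs), abs_neg]
    rfl

/-- The pairs `(a, b) = (n + s, n)` and `(n, n - s)` have the same difference `s`, hence lead to the
same Fock space. -/
theorem fockSobolev_eq_fockSpace {n : ℕ} (hn : 0 < n) {p : ℝ≥0∞} (hp : p ≠ 0) {α α' s : ℝ}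
    (hα : weightExp p α' = weightExp p α + s) :
    FSSpace n p α s = FSTildeSpace n p α s ∧
      FSTildeSpace n p α s = FockSpace n p α' ∧
      EquivNorms (n := n) (FSNorm p α s) (FSTildeNorm p α s) ∧
      EquivNorms (n := n) (FSNorm p α s) (LNorm p α') ∧
      EquivNorms (n := n) (FSTildeNorm p α s) (LNorm p α') := by
  have hn' : (0 : ℝ) < n := Nat.cast_pos.mpr hn
  have h1 := fockSobolev_of_gammaRatio (n := n) (K := firstIndex s) hp (α := α) (α' := α')
    (a := n + s) (b := n) (by rw [hα]; ring) (add_firstIndex_pos hn s) (by positivity)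
    (op := radDeriv s) (fun f z => by
      rw [radDeriv, fracDeriv_eq_multiplier, add_sub_cancel_left])
  have h2 := fockSobolev_of_gammaRatio (n := n) (K := firstIndex (-s)) hp (α := α) (α' := α')
    (a := n) (b := n + -s) (by rw [hα]; ring) (by positivity) (add_firstIndex_pos hn (-s))
    (op := radInt s) (fun f z => by
      rw [radInt, fracInt_eq_multiplier, show (n : ℝ) - (n + -s) = s by ring])
  rw [← FSNorm_eq hp] at h1
  rw [← FSTildeNorm_eq hp] at h2
  exact ⟨h1.1.trans h2.1.symm, h2.1, h1.2.trans h2.2.symm, h1.2, h2.2⟩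

end FockSobolev

open FockSobolev
theorem theorem4p2 (n : ℕ) (hn : 0 < n) (s α : ℝ) :
    (∀ p : ℝ≥0∞, 0 < p → p < ∞ →
      FSSpace n p α s = FSTildeSpace n p α s ∧
      FSTildeSpace n p α s = FockSpace n p (α - s * p.toReal) ∧
      EquivNorms (n := n) (FSNorm p α s) (FSTildeNorm p α s) ∧
      EquivNorms (n := n) (FSNorm p α s) (LNorm p (α - s * p.toReal)) ∧
      EquivNorms (n := n) (FSTildeNorm p α s) (LNorm p (α - s * p.toReal))) ∧
    (FSSpace n ∞ α s = FSTildeSpace n ∞ α s ∧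
      FSTildeSpace n ∞ α s = FockSpace n ∞ (α - s) ∧
      EquivNorms (n := n) (FSNorm ∞ α s) (FSTildeNorm ∞ α s) ∧
      EquivNorms (n := n) (FSNorm ∞ α s) (LNorm ∞ (α - s)) ∧
      EquivNorms (n := n) (FSTildeNorm ∞ α s) (LNorm ∞ (α - s))) := by
  refine ⟨fun p hp hpt => fockSobolev_eq_fockSpace hn hp.ne' ?_,
    fockSobolev_eq_fockSpace hn ENNReal.top_ne_zero ?_⟩
  · have hq := ENNReal.toReal_pos hp.ne' hpt.ne
    rw [weightExp, weightExp, if_neg hpt.ne, if_neg hpt.ne]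
    field_simp
    ring
  · rw [weightExp, weightExp, if_pos rfl, if_pos rfl]
    ring
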